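/- Let $(a_n)_{n\ge 0}$ be positive step sizes, let $G$ be a set-valued map assigning to each $x\in\mathbb R^d$ a subset of $\mathbb R^d$, let $b_n:\mathbb R^d\to\mathbb R^d$ satisfy $b_n(x)\in G(x)$ for all $n$ and $x$, and let the random sequence $(X_n)_{n\ge0}$ in $\mathbb R^d$ satisfy $$X_{n+1}=X_n+a_n h(X_n,\xi_n)+a_n b_n(X_n),\qquad n\ge 0 .$$ The noise $(\xi_n)$ takes values in a metric space and is exogenous: for every $n$, the conditional law of $(\xi_i)_{i>n}$ given $(\xi_i,X_i)_{i\le n}$ equals its conditional law given $(\xi_i)_{i\le n}$ (as is the case when $X_0$ is deterministic). Suppose that, with probability one, $(X_n)$ is bounded and $X_n\to x^*$, where $x^*\in\mathbb R^d$ is deterministic. **Noise.** $h(x,\xi)$ and its $x$-derivative $h_x(x,\xi)$ are continuous in $(x,\xi)$ and bounded on bounded $x$-sets (uniformly in $\xi$); the second $x$-derivative $h_{xx}(x,\xi)$ exists, is bounded on bounded $x$-sets uniformly in $\xi$, and for each $\xi$ is continuous in $x$ near $x^*$. The process $(\xi_n)$ is uniformly bounded and stationary, with $\mathbb E h(x,\xi_n)=\bar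 h(x)$ and $\mathbb E h_x(x,\xi_n)=\bar h_x(x)$, where $\bar h_x$ is the derivative of $\bar h$. Put $\psi_n=h(x^*,\xi_n)-\bar h(x^*)$, $\tilde\psi_n=h_x(x^*,\xi_n)-\bar h_x(x^*)$, $\mathcal F_n=\sigma(\xi_j:j\le n)$ and $$\phi(m)=\sup_{n}\ \sup_{A\in\sigma(\psi_j:\,j\ge n+m)}\big\|\mathbb P(A\mid\mathcal F_n)-\mathbb P(A)\big\|_{L^\infty},\qquad \tilde\phi(m)=\sup_{n}\ \sup_{A\in\sigma(\tilde\psi_j:\,j\ge n+m)}\big\|\mathbb P(A\mid\mathcal F_n)-\mathbb P(A)\big\|_{L^\infty}.$$ For some $\Delta>0$, $\sum_m\phi(m)^{\Delta/(1+\Delta)}<\infty$ and $\sum_m\tilde\phi(m)^{\Delta/(1+\Delta)}<\infty$. **Lyapunov function.** There are constants $K$, $c_0>0$, $\lambda>0$ and a $C^2$ function $V:\mathbb R^d\to\mathbb R$ such that: - $V(x^*)=0$, $V(x)>0$ for $x\ne x^*$, $|\nabla V(x)|^2\le K(1+V(x))$ for all $x$, the second derivative of $V$ is bounded on $\mathbb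 R^d$, and $V(x)\ge c_0|x-x^*|^2+o(|x-x^*|^2)$ as $x\to x^*$; - for every $x\neq x^*$, every element of the set-valued derivative $\dot{\overline V}^{\,G+\bar h}(x)$ is at most $-\lambda V(x)$. Here, for a set-valued map $F$, $\dot{\overline V}^{F}(x)$ is the set of all $a\in\mathbb R$ for which there is $q\in F(x)$ with $p^\top q=a$ for all $p\in\partial V(x)$, where the Clarke gradient $\partial V(x)$ is the closed convex hull of all limits $\lim_i\nabla V(x_i)$ along sequences $x_i\to x$ of points of differentiability of $V$; and $(G+\bar h)(x)=\{q+\bar h(x):q\in G(x)\}$; - $|b_n(x)|^2+|h(x,\xi)|^2\le K(1+V(x))$ for all $n$, $x$, $\xi$. **Step sizes.** Let $t_n=\sum_{i=0}^{n-1}a_i$, and let $m(t)=\max\{n:t_n\le t\}$ for $t\ge0$ and $m(t)=0$ for $t<0$. Either $a_n=1/n$ for all $n\ge1$ and $\lambda>1$; or $a_n\to0$ and, for each $T>0$, $$\liminf_{n\to\infty}\ \min_{m(t_n-T)\le i\le n}\frac{a_n}{a_i}=1 .$$ Then there is an $N$ such that the family $\{(X_n-x^*)/\sqrt{a_n}:n\ge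 N\}$ is tight in $\mathbb R^d$. -/

import Mathlib

open MeasureTheory Filter Topology Asymptotics
open scoped ENNReal Pointwise

noncomputable section

namespace StochApprox

/-! ### Set-valued derivative -/

/-- The Clarke gradient of `V` at `x`: the closed convex hull of all limits of gradients
`∇V (u i)` along sequences `u i → x` of points at which `V` is differentiable. -/
def clarkeGradient {d : ℕ} (V : EuclideanSpace ℝ (Fin d) → ℝ) (x : EuclideanSpace ℝ (Fin d)) :
    Set (EuclideanSpace ℝ (Fin d)) :=
  closure (convexHull ℝ {p | ∃ u : ℕ → EuclideanSpace ℝ (Fin d),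
    Tendsto u atTop (𝓝 x) ∧ (∀ i, DifferentiableAt ℝ V (u i)) ∧
      Tendsto (fun i => gradient V (u i)) atTop (𝓝 p)})

/-- The set-valued derivative of `V` at `x` with respect to the set-valued map `F`: all reals `a`
for which there is `q ∈ F x` with `⟪p, q⟫ = a` for every `p` in the Clarke gradient. -/
def setValuedDeriv {d : ℕ} (V : EuclideanSpace ℝ (Fin d) → ℝ)
    (F : EuclideanSpace ℝ (Fin d) → Set (EuclideanSpace ℝ (Fin d)))
    (x : EuclideanSpace ℝ (Fin d)) : Set ℝ :=
  {a | ∃ q ∈ F x, ∀ p ∈ clarkeGradient V x, inner ℝ p q = a}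

/-! ### Interpolation times -/

/-- `t_n = ∑_{i < n} a_i`. -/
def interpTime (a : ℕ → ℝ) (n : ℕ) : ℝ := ∑ i ∈ Finset.range n, a i

/-- `m(s) = max {n : t_n ≤ s}` for `s ≥ 0`, and `m(s) = 0` for `s < 0` (for positive `a` the set
is then empty). -/
def interpIndex (a : ℕ → ℝ) (s : ℝ) : ℕ := sSup {n | interpTime a n ≤ s}

/-- For each `T > 0`, `liminf_n min_{n ≥ i ≥ m(t_n - T)} a_n / a_i = 1`. -/
def SlowlyVarying (a : ℕ → ℝ) : Prop :=
  ∀ T : ℝ, 0 < T →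
    liminf (fun n => sInf ((fun i => a n / a i) ''
      Set.Icc (interpIndex a (interpTime a n - T)) n)) atTop = 1

/-! ### Mixing and exogenous noise -/

/-- The σ-algebra generated by `Y_j`, `j ≤ n`. -/
@[reducible]
def pastAlg {Ω S : Type*} [MeasurableSpace S] (Y : ℕ → Ω → S) (n : ℕ) : MeasurableSpace Ω :=
  ⨆ j : ℕ, ⨆ _ : j ≤ n, MeasurableSpace.comap (Y j) inferInstance

/-- The σ-algebra generated by `Y_j`, `j ≥ n`. -/
@[reducible]
def futureAlg {Ω S : Type*} [MeasurableSpace S] (Y : ℕ → Ω → S) (n : ℕ) : MeasurableSpace Ω :=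
  ⨆ j : ℕ, ⨆ _ : n ≤ j, MeasurableSpace.comap (Y j) inferInstance

/-- The conditional probability `P(A | m)`. -/
def condProb {Ω : Type*} [MeasurableSpace Ω] (μ : Measure Ω) (m : MeasurableSpace Ω)
    (A : Set Ω) : Ω → ℝ :=
  μ[A.indicator (fun _ => (1 : ℝ)) | m]

/-- The uniform mixing coefficient of `Y` relative to the history of the noise `ξ`:
`φ(k) = sup_n sup_A |P(A | σ(ξ_j ; j ≤ n)) - P(A)|_∞`, where `A` ranges over `σ(Y_j ; j ≥ n + k)`
and `|·|_∞` is the norm of `L^∞`. -/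
def mixCoeff {Ω Ξ S : Type*} [MeasurableSpace Ω] [MeasurableSpace Ξ] [MeasurableSpace S]
    (μ : Measure Ω) (ξ : ℕ → Ω → Ξ) (Y : ℕ → Ω → S) (k : ℕ) : ℝ≥0∞ :=
  ⨆ (n : ℕ) (A : Set Ω) (_ : MeasurableSet[futureAlg Y (n + k)] A),
    eLpNorm (fun ω => condProb μ (pastAlg ξ n) A ω - μ.real A) ∞ μ

/-- The noise `ξ` is exogenous for `X`: the conditional law of `(ξ_i)_{i > n}` given
`(ξ_i, X_i)_{i ≤ n}` is its conditional law given `(ξ_i)_{i ≤ n}`. -/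
def Exogenous {Ω Ξ S : Type*} [MeasurableSpace Ω] [MeasurableSpace Ξ] [MeasurableSpace S]
    (μ : Measure Ω) (ξ : ℕ → Ω → Ξ) (X : ℕ → Ω → S) : Prop :=
  ∀ (n : ℕ) (A : Set Ω), MeasurableSet[futureAlg ξ (n + 1)] A →
    condProb μ (pastAlg ξ n ⊔ pastAlg X n) A =ᵐ[μ] condProb μ (pastAlg ξ n) A

/-- The conditions on `h` and on the noise `ξ` with averaged function `hbar`, relative to the
point `xs`. Here `h_x(x, z) = fderiv ℝ (fun y => h y z) x`, and `h_xx(·, z)` is its derivative. -/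
structure NoiseCondition {d : ℕ} {Ω Ξ : Type*} [MeasurableSpace Ω]
    [PseudoMetricSpace Ξ] [MeasurableSpace Ξ] (μ : Measure Ω)
    (h : EuclideanSpace ℝ (Fin d) → Ξ → EuclideanSpace ℝ (Fin d))
    (hbar : EuclideanSpace ℝ (Fin d) → EuclideanSpace ℝ (Fin d))
    (ξ : ℕ → Ω → Ξ) (xs : EuclideanSpace ℝ (Fin d)) : Prop where
  /-- `h` is jointly continuous. -/
  continuous_h : Continuous fun p : EuclideanSpace ℝ (Fin d) × Ξ => h p.1 p.2
  /-- `h_x` exists. -/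
  differentiable_h : ∀ z, Differentiable ℝ fun x => h x z
  /-- `h_x` is jointly continuous. -/
  continuous_hx : Continuous fun p : EuclideanSpace ℝ (Fin d) × Ξ =>
    fderiv ℝ (fun x => h x p.2) p.1
  /-- `h` and `h_x` are bounded on bounded `x`-sets. -/
  bounded_h : ∀ R : ℝ, ∃ C : ℝ, ∀ x, ‖x‖ ≤ R → ∀ z,
    ‖h x z‖ ≤ C ∧ ‖fderiv ℝ (fun y => h y z) x‖ ≤ C
  /-- `h_xx` exists. -/
  differentiable_hx : ∀ z, Differentiable ℝ (fderiv ℝ fun x => h x z)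
  /-- `h_xx` is bounded on bounded `x`-sets, uniformly in the noise variable. -/
  bounded_hxx : ∀ R : ℝ, ∃ C : ℝ, ∀ x, ‖x‖ ≤ R → ∀ z,
    ‖fderiv ℝ (fderiv ℝ fun y => h y z) x‖ ≤ C
  /-- `h_xx(·, z)` is continuous in a neighbourhood of `xs`. -/
  continuous_hxx : ∀ z, ∃ U ∈ 𝓝 xs, ContinuousOn (fderiv ℝ (fderiv ℝ fun y => h y z)) U
  /-- Each `ξ_n` is a random variable. -/
  measurable_ξ : ∀ n, Measurable (ξ n)
  /-- The noise is uniformly bounded. -/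
  bounded_ξ : ∃ S : Set Ξ, Bornology.IsBounded S ∧ ∀ n, ∀ᵐ ω ∂μ, ξ n ω ∈ S
  /-- The noise is stationary. -/
  stationary_ξ : ∀ k : ℕ,
    μ.map (fun ω (n : ℕ) => ξ (n + k) ω) = μ.map (fun ω (n : ℕ) => ξ n ω)
  /-- `E h(x, ξ_n) = hbar(x)`. -/
  mean_h : ∀ n x, ∫ ω, h x (ξ n ω) ∂μ = hbar x
  /-- `E h_x(x, ξ_n) = hbar_x(x)`. -/
  mean_hx : ∀ n x, HasFDerivAt hbar (∫ ω, fderiv ℝ (fun y => h y (ξ n ω)) x ∂μ) x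
  /-- The coefficients of `ψ_n = h(xs, ξ_n) - hbar(xs)` and of
  `h_x(xs, ξ_n) - hbar_x(xs)`, raised to the power `Δ / (1 + Δ)`, are summable. -/
  mixing : ∃ Δ : ℝ, 0 < Δ ∧
    ∑' k, mixCoeff μ ξ (fun n ω => h xs (ξ n ω) - hbar xs) k ^ (Δ / (1 + Δ)) ≠ ∞ ∧
    ∑' k, mixCoeff μ ξ (fun n ω => fderiv ℝ (fun y => h y (ξ n ω)) xs - fderiv ℝ hbar xs) k
      ^ (Δ / (1 + Δ)) ≠ ∞

/-- The conditions on the Lyapunov function `V` relative to the point `xs`, with growth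
constant `K`, lower quadratic constant `c₀` and decay rate `lam` along the set-valued map `F`. -/
structure IsLyapunov {d : ℕ} (V : EuclideanSpace ℝ (Fin d) → ℝ)
    (F : EuclideanSpace ℝ (Fin d) → Set (EuclideanSpace ℝ (Fin d)))
    (xs : EuclideanSpace ℝ (Fin d)) (K c₀ lam : ℝ) : Prop where
  zero : V xs = 0
  pos : ∀ x, x ≠ xs → 0 < V x
  contDiff : ContDiff ℝ 2 V
  grad_growth : ∀ x, ‖gradient V x‖ ^ 2 ≤ K * (1 + V x)
  hess_bounded : ∃ C : ℝ, ∀ x, ‖fderiv ℝ (fderiv ℝ V) x‖ ≤ C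
  /-- `V(x) ≥ c₀ |x - xs|² + o(|x - xs|²)` as `x → xs`. -/
  quadratic_lower : ∃ r : EuclideanSpace ℝ (Fin d) → ℝ,
    r =o[𝓝 xs] (fun x => ‖x - xs‖ ^ 2) ∧ ∀ᶠ x in 𝓝 xs, c₀ * ‖x - xs‖ ^ 2 + r x ≤ V x
  /-- Every element of the set-valued derivative along `F` is at most `-lam V`. -/
  decay : ∀ x, x ≠ xs → ∀ v ∈ setValuedDeriv V F x, v ≤ -lam * V x

end StochApprox

end

/-! Let D_n be the event that X stays in a small closed ball about x* from time N through time n,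
and let u_n = E[V(X_n); D_n]. Almost sure convergence makes leaving the ball after N improbable once
N is large, and V dominates a multiple of |x - x*|² on the ball. By Markov's inequality, tightness
therefore follows from u_n = O(a_n) for each large fixed N (`isTightMeasureSet_of_localized_bound`).

Expanding V to second order and linearizing the noise at x* gives, for some l with ρ < l < λ,
u_{n+1} ≤ (1 - l a_n) u_n + a_n c(n,n) + O(a_n²) - κ P(D_n \ D_{n+1}), where c(n,i) pairs stopped
functions of X_n with the centred noise at time i. The linearization error is cubic in |x - x*| and
is absorbed into the gap λ - l. Since c(n,n) is only O(1), the noise must be averaged: adding ∑_{n ≤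
i < m} a_i c(n,i) to u_n cancels a_n c(n,n) and leaves the differences c(n+1,i) - c(n,i), of order
φ(i-n-1)(a_n + P(D_n \ D_{n+1})). The exit probability need not be O(a_n); it is paid for by the
term -κ P(D_n \ D_{n+1}), the value of V lost on leaving the ball. This is a perturbed Lyapunov
function built from covariances instead of conditional expectations (`perturbed_recursion_bound`,
`exists_integral_indicator_le`). The covariances decay summably by uniform mixing, which exogeneity
extends from the noise history to the joint history (`Exogenous.abs_integral_mul_clm_le`).

Both step-size regimes enter only through a_i ≤ C exp(ρ(t_m - t_i)) a_m with ρ < λ, and contraction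
at rate l > ρ turns the O(a_n²) errors into u_m = O(a_m). For a_n = 1/n one takes ρ = 1, whence λ >
1; slowly varying steps allow every ρ > 0. -/

namespace StochApprox

/-! ### Taylor estimates and the Lyapunov function -/

/-- Second-order Taylor estimate on a convex set where the second derivative is bounded. -/
theorem norm_taylor_le {E F : Type*} [NormedAddCommGroup E] [NormedSpace ℝ E]
    [NormedAddCommGroup F] [NormedSpace ℝ F] {f : E → F} (hf : Differentiable ℝ f)
    (hf' : Differentiable ℝ (fderiv ℝ f)) {s : Set E} (hs : Convex ℝ s) {C : ℝ}
    (hC : ∀ x ∈ s, ‖fderiv ℝ (fderiv ℝ f) x‖ ≤ C) {x y : E} (hx : x ∈ s) (hy : y ∈ s) :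
    ‖f y - f x - fderiv ℝ f x (y - x)‖ ≤ C * ‖y - x‖ ^ 2 := by
  have hC0 : 0 ≤ C := le_trans (norm_nonneg (fderiv ℝ (fderiv ℝ f) x)) (hC x hx)
  have hseg : segment ℝ x y ⊆ s := hs.segment_subset hx hy
  -- The mean value inequality is used twice, for the derivative on `s` and then for `f` on the
  -- segment; this loses only the factor 1/2.
  have key : ∀ z ∈ segment ℝ x y, ‖fderiv ℝ f z - fderiv ℝ f x‖ ≤ C * ‖y - x‖ := by
    intro z hz
    refine (hs.norm_image_sub_le_of_norm_fderiv_le (fun w _ => hf' w) hC hx (hseg hz)).trans ?_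
    gcongr
    exact norm_sub_le_of_mem_segment hz
  calc ‖f y - f x - fderiv ℝ f x (y - x)‖ ≤ C * ‖y - x‖ * ‖y - x‖ :=
        (convex_segment x y).norm_image_sub_le_of_norm_fderiv_le' (fun w _ => hf w) key
          (left_mem_segment ℝ x y) (right_mem_segment ℝ x y)
    _ = C * ‖y - x‖ ^ 2 := by ring

theorem inner_gradient_eq {d : ℕ} (V : EuclideanSpace ℝ (Fin d) → ℝ)
    (x y : EuclideanSpace ℝ (Fin d)) : inner ℝ (gradient V x) y = fderiv ℝ V x y := by
  simp [gradient, InnerProductSpace.toDual_symm_apply]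

/-- The Clarke gradient of a `C¹` function is at most its gradient. -/
theorem clarkeGradient_subset {d : ℕ} {V : EuclideanSpace ℝ (Fin d) → ℝ} (hV : ContDiff ℝ 1 V)
    (x : EuclideanSpace ℝ (Fin d)) : clarkeGradient V x ⊆ {gradient V x} := by
  have hc : Continuous (gradient V) :=
    (InnerProductSpace.toDual ℝ _).symm.continuous.comp (hV.continuous_fderiv (by norm_num))
  refine closure_minimal (convexHull_min ?_ (convex_singleton _)) isClosed_singleton
  rintro p ⟨u, hu, -, hp⟩
  exact tendsto_nhds_unique hp ((hc.tendsto x).comp hu)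

/-- The set-valued decay condition in terms of the derivative of `V`. -/
theorem IsLyapunov.fderiv_le {d : ℕ} {V : EuclideanSpace ℝ (Fin d) → ℝ}
    {F : EuclideanSpace ℝ (Fin d) → Set (EuclideanSpace ℝ (Fin d))}
    {xs : EuclideanSpace ℝ (Fin d)} {K c₀ lam : ℝ} (hV : IsLyapunov V F xs K c₀ lam)
    (x q : EuclideanSpace ℝ (Fin d)) (hq : q ∈ F x) :
    fderiv ℝ V x q ≤ -lam * V x := by
  by_cases hx : x = xs
  · subst hx
    have hmin : IsLocalMin V x := by
      refine Filter.Eventually.of_forall fun y => ?_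
      by_cases hy : y = x
      · rw [hy]
      · rw [hV.zero]; exact (hV.pos y hy).le
    rw [hmin.fderiv_eq_zero, hV.zero]
    simp
  -- Inclusion of the Clarke gradient in `{gradient V x}` is enough: the set-valued derivative asks
  -- for a common value over all its elements.
  · refine hV.decay x hx _ ⟨q, hq, fun p hp => ?_⟩
    rw [clarkeGradient_subset (hV.contDiff.of_le (by norm_num)) x hp, inner_gradient_eq]

theorem IsLyapunov.nonneg {d : ℕ} {V : EuclideanSpace ℝ (Fin d) → ℝ}
    {F : EuclideanSpace ℝ (Fin d) → Set (EuclideanSpace ℝ (Fin d))}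
    {xs : EuclideanSpace ℝ (Fin d)} {K c₀ lam : ℝ} (hV : IsLyapunov V F xs K c₀ lam)
    (x : EuclideanSpace ℝ (Fin d)) : 0 ≤ V x := by
  by_cases hx : x = xs
  · rw [hx, hV.zero]
  · exact (hV.pos x hx).le

theorem IsLyapunov.fderiv_eq_zero {d : ℕ} {V : EuclideanSpace ℝ (Fin d) → ℝ}
    {F : EuclideanSpace ℝ (Fin d) → Set (EuclideanSpace ℝ (Fin d))}
    {xs : EuclideanSpace ℝ (Fin d)} {K c₀ lam : ℝ} (hV : IsLyapunov V F xs K c₀ lam) :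
    fderiv ℝ V xs = 0 := by
  have hmin : IsLocalMin V xs :=
    Filter.Eventually.of_forall fun y => by rw [hV.zero]; exact hV.nonneg y
  exact hmin.fderiv_eq_zero

/-! ### Step sizes -/

theorem interpTime_succ (a : ℕ → ℝ) (n : ℕ) : interpTime a (n + 1) = interpTime a n + a n :=
  Finset.sum_range_succ _ _

theorem interpTime_strictMono {a : ℕ → ℝ} (ha : ∀ n, 0 < a n) : StrictMono (interpTime a) :=
  strictMono_nat_of_lt_succ fun n => by rw [interpTime_succ]; linarith [ha n]

/-- The step sizes decrease at most at exponential rate `ρ` in the interpolation time. -/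
def DecreasesAtMost (a : ℕ → ℝ) (ρ : ℝ) : Prop :=
  ∃ C : ℝ, ∃ N : ℕ, ∀ i m : ℕ, N ≤ i → i ≤ m →
    a i ≤ C * Real.exp (ρ * (interpTime a m - interpTime a i)) * a m

/-- Here a_m / a_{m+1} = 1 + a_m ≤ exp(a_m), and multiplying these ratios gives rate exactly 1. -/
theorem decreasesAtMost_of_eq_one_div {a : ℕ → ℝ} (h : ∀ n : ℕ, 1 ≤ n → a n = 1 / (n : ℝ)) :
    DecreasesAtMost a 1 := by
  refine ⟨1, 1, fun i m hi him => ?_⟩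
  induction m, him using Nat.le_induction with
  | base => simp
  | succ m him ih =>
    have hm : (1 : ℝ) ≤ m := by exact_mod_cast hi.trans him
    rw [interpTime_succ, show (1 : ℝ) * (interpTime a m + a m - interpTime a i)
      = 1 * (interpTime a m - interpTime a i) + a m by ring, Real.exp_add]
    refine ih.trans ?_
    have h1 : a m ≤ Real.exp (a m) * a (m + 1) := by
      have h2 := Real.add_one_le_exp (a m)
      have h3 : a m = (a m + 1) * a (m + 1) := by
        rw [h m (hi.trans him), h (m + 1) (by omega)]
        push_cast
        field_simp
        ring
      have h4 : 0 ≤ a (m + 1) := by rw [h (m + 1) (by omega)]; positivity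
      calc a m = (a m + 1) * a (m + 1) := h3
        _ ≤ _ := by gcongr
    calc _ ≤ 1 * Real.exp (1 * (interpTime a m - interpTime a i)) *
            (Real.exp (a m) * a (m + 1)) := by gcongr
      _ = _ := by ring

theorem SlowlyVarying.eventually_le {a : ℕ → ℝ} (ha : ∀ n, 0 < a n) (hs : SlowlyVarying a)
    {T q : ℝ} (hT : 0 < T) (hq : 1 < q) :
    ∀ᶠ n in atTop, ∀ i ≤ n, interpTime a n - interpTime a i < T → a i ≤ q * a n := by
  have hq' : q⁻¹ < liminf (fun n => sInf ((fun i => a n / a i) ''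
      Set.Icc (interpIndex a (interpTime a n - T)) n)) atTop := by
    rw [hs T hT]; exact inv_lt_one_of_one_lt₀ hq
  -- The real-valued `liminf` is informative only for a function bounded below; positivity of the
  -- ratios supplies the bound.
  have hb : IsBoundedUnder (· ≥ ·) atTop (fun n => sInf ((fun i => a n / a i) ''
      Set.Icc (interpIndex a (interpTime a n - T)) n)) := by
    refine ⟨0, Filter.eventually_map.2 (Filter.Eventually.of_forall fun n => ?_)⟩
    refine Real.sInf_nonneg ?_
    rintro _ ⟨i, -, rfl⟩
    exact (div_pos (ha n) (ha i)).le
  filter_upwards [eventually_lt_of_lt_liminf hq' hb] with n hn i hi hti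
  have hmem : i ∈ Set.Icc (interpIndex a (interpTime a n - T)) n := by
    refine ⟨?_, hi⟩
    rcases Set.eq_empty_or_nonempty {k | interpTime a k ≤ interpTime a n - T} with he | hne
    · simp [interpIndex, he]
    · refine csSup_le hne fun k hk => ?_
      refine ((interpTime_strictMono ha).lt_iff_lt.1 ?_).le
      have : interpTime a k ≤ interpTime a n - T := hk
      linarith
  have hle := csInf_le ((Set.finite_Icc _ _).image (fun i => a n / a i)).bddBelow
    (Set.mem_image_of_mem (fun i => a n / a i) hmem)
  have h1 : q⁻¹ < a n / a i := hn.trans_le hle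
  rw [lt_div_iff₀ (ha i), inv_mul_lt_iff₀ (by linarith)] at h1
  exact h1.le

/-- Over an interpolated time below 2 the step shrinks by a factor at most e^ρ. The interval from
t_i to t_m is cut into blocks of length between 1 and 2, each costing e^ρ while using up time at
least 1; the last, incomplete block gives the constant e^ρ. -/
theorem SlowlyVarying.decreasesAtMost {a : ℕ → ℝ} (ha : ∀ n, 0 < a n) (hs : SlowlyVarying a)
    (h0 : Tendsto a atTop (𝓝 0)) {ρ : ℝ} (hρ : 0 < ρ) : DecreasesAtMost a ρ := by
  have h1 := hs.eventually_le ha (T := 2) (by norm_num) (Real.one_lt_exp_iff.2 hρ)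
  have h2 := h0.eventually (gt_mem_nhds (zero_lt_one))
  obtain ⟨N, hN⟩ := eventually_atTop.1 (h1.and h2)
  refine ⟨Real.exp ρ, N, fun i m hi him => ?_⟩
  have hmono := (interpTime_strictMono ha).monotone
  induction hk : m - i using Nat.strong_induction_on generalizing i with
  | _ k ih =>
    by_cases hlt : interpTime a m - interpTime a i < 2
    · refine ((hN m (hi.trans him)).1 i him hlt).trans ?_
      have h3 : 1 ≤ Real.exp (ρ * (interpTime a m - interpTime a i)) :=
        Real.one_le_exp (mul_nonneg hρ.le (sub_nonneg.2 (hmono him)))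
      have := mul_pos (Real.exp_pos ρ) (ha m)
      nlinarith
    · have hex : ∃ j, interpTime a i + 1 ≤ interpTime a j := ⟨m, by linarith⟩
      classical
      -- The first index at least one time unit after `i`; as steps are below 1, the overshoot keeps
      -- it within two units.
      set j := Nat.find hex with hj
      have hj1 : interpTime a i + 1 ≤ interpTime a j := Nat.find_spec hex
      have hij : i < j := (interpTime_strictMono ha).lt_iff_lt.1 (by linarith)
      have hjm : j ≤ m := Nat.find_min' hex (by linarith)
      have hj2 : interpTime a j < interpTime a i + 2 := by
        have h4 := Nat.find_min hex (m := j - 1) (by omega)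
        have h5 := interpTime_succ a (j - 1)
        rw [Nat.sub_add_cancel (by omega)] at h5
        have h6 := (hN (j - 1) (by omega)).2
        push Not at h4
        linarith
      have h7 := (hN j (by omega)).1 i hij.le (by linarith)
      have h8 := ih (m - j) (by omega) j (by omega) hjm rfl
      have h9 : Real.exp (ρ * (interpTime a m - interpTime a i))
          ≥ Real.exp ρ * Real.exp (ρ * (interpTime a m - interpTime a j)) := by
        rw [← Real.exp_add]
        apply Real.exp_le_exp.2
        nlinarith
      have := (ha m).le
      calc a i ≤ Real.exp ρ * a j := h7
        _ ≤ Real.exp ρ * (Real.exp ρ * Real.exp (ρ * (interpTime a m - interpTime a j)) * a m) := by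
          gcongr
        _ = Real.exp ρ * (Real.exp ρ * Real.exp (ρ * (interpTime a m - interpTime a j))) * a m := by
          ring
        _ ≤ _ := by gcongr

/-! ### The deterministic perturbed Lyapunov recursion -/

/-- A perturbed Lyapunov recursion in expectation. Here `u n` is the mean Lyapunov function,
`e n` an exit probability, and `c n i` the covariance of the state at time `n` with the noise at
time `i`. -/
theorem perturbed_recursion_bound {a u e φ : ℕ → ℝ} {c : ℕ → ℕ → ℝ} {l ρ C κ S A : ℝ} {N : ℕ}
    (ha : ∀ n, 0 < a n) (hC : 0 ≤ C) (hρ : 0 ≤ ρ) (hρl : ρ < l)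
    (hφ0 : ∀ n, 0 ≤ φ n) (hφ : ∀ s : Finset ℕ, ∑ k ∈ s, φ k ≤ S)
    (he : ∀ n, 0 ≤ e n)
    (hstep : ∀ n, N ≤ n → l * a n ≤ 1)
    (hA : ∀ n, N ≤ n → a n ≤ A) (hsmall : C * (A * S) ≤ κ)
    (hrec : ∀ n, N ≤ n → u (n + 1) ≤ (1 - l * a n) * u n + a n * c n n + C * a n ^ 2 - κ * e n)
    (hc : ∀ n i, N ≤ n → n ≤ i → |c n i| ≤ C * φ (i - n))
    (hdc : ∀ n i, N ≤ n → n + 1 ≤ i → |c (n + 1) i - c n i| ≤ C * φ (i - (n + 1)) * (a n + e n))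
    (hdec : ∀ i m : ℕ, N ≤ i → i ≤ m →
      a i ≤ C * Real.exp (ρ * (interpTime a m - interpTime a i)) * a m) :
    ∃ B : ℝ, ∀ m, N ≤ m → u m ≤ B * a m := by
  have hmono := (interpTime_strictMono ha).monotone
  have hS : 0 ≤ S := by simpa using hφ ∅
  have hgap : 0 < l - ρ := by linarith
  set C₁ : ℝ := l * (C * (S * C)) + C * C + C * (S * C) with hC₁
  have hl : 0 ≤ l := by linarith
  have hC₁0 : 0 ≤ C₁ := by positivity
  -- The first entry covers the initial time `N`; the second makes C₁ ≤ B(l - ρ), the balance needed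
  -- in the induction step.
  refine ⟨max (|u N| / a N * C + C * (S * C)) (C₁ / (l - ρ)), fun m hm => ?_⟩
  set B : ℝ := max (|u N| / a N * C + C * (S * C)) (C₁ / (l - ρ)) with hB
  have hB0 : 0 ≤ B := le_max_of_le_right (by positivity)
  -- With the terminal time `m` fixed, `C * E` is an envelope for the steps up to `m`, with `E m = a
  -- m`; `p` is the perturbation added to `u`, and `α` controls its size.
  set E : ℕ → ℝ := fun n => Real.exp (ρ * (interpTime a m - interpTime a n)) * a m with hE
  set α : ℕ → ℝ := fun n => ∑ i ∈ Finset.Ico n m, a i * φ (i - n) with hα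
  set p : ℕ → ℝ := fun n => ∑ i ∈ Finset.Ico n m, a i * c n i with hp
  have hE0 : ∀ n, 0 ≤ E n := fun n => mul_nonneg (Real.exp_pos _).le (ha m).le
  have hEanti : ∀ {i n}, n ≤ i → E i ≤ E n := fun {i n} h => by
    refine mul_le_mul_of_nonneg_right (Real.exp_le_exp.2 ?_) (ha m).le
    exact mul_le_mul_of_nonneg_left (by linarith [hmono h]) hρ
  have haE : ∀ i, N ≤ i → i ≤ m → a i ≤ C * E i := fun i h1 h2 =>
    (hdec i m h1 h2).trans_eq (by rw [hE]; ring)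
  have hαle : ∀ n D, (∀ i, n ≤ i → i < m → a i ≤ D) → 0 ≤ D → α n ≤ D * S := by
    intro n D hD hD0
    calc α n ≤ ∑ i ∈ Finset.Ico n m, D * φ (i - n) := by
          refine Finset.sum_le_sum fun i hi => ?_
          rw [Finset.mem_Ico] at hi
          exact mul_le_mul_of_nonneg_right (hD i hi.1 hi.2) (hφ0 _)
      _ = D * ∑ i ∈ Finset.range (m - n), φ i := by
          rw [← Finset.mul_sum, Finset.sum_Ico_eq_sum_range]
          simp
      _ ≤ D * S := mul_le_mul_of_nonneg_left (hφ _) hD0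
  have hαE : ∀ n, N ≤ n → α n ≤ C * E n * S := fun n hn =>
    hαle n _ (fun i h1 h2 => (haE i (hn.trans h1) h2.le).trans
      (mul_le_mul_of_nonneg_left (hEanti h1) hC)) (mul_nonneg hC (hE0 n))
  have hA0 : 0 ≤ A := (ha N).le.trans (hA N le_rfl)
  -- A second bound on `α`, small rather than proportional to `E`, reserved for the exit terms.
  have hαA : ∀ n, N ≤ n → α n ≤ A * S := fun n hn =>
    hαle n _ (fun i h1 _ => hA i (hn.trans h1)) hA0
  have hpα : ∀ n, N ≤ n → |p n| ≤ C * α n := by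
    intro n hn
    refine (Finset.abs_sum_le_sum_abs _ _).trans ?_
    rw [hα, Finset.mul_sum]
    refine Finset.sum_le_sum fun i hi => ?_
    rw [abs_mul, abs_of_pos (ha i)]
    calc a i * |c n i| ≤ a i * (C * φ (i - n)) :=
          mul_le_mul_of_nonneg_left (hc n i hn (Finset.mem_Ico.1 hi).1) (ha i).le
      _ = _ := by ring
  have hpE : ∀ n, N ≤ n → |p n| ≤ C * (S * C) * E n := fun n hn =>
    (hpα n hn).trans ((mul_le_mul_of_nonneg_left (hαE n hn) hC).trans_eq (by ring))
  have key : ∀ n, N ≤ n → n ≤ m → u n + p n ≤ B * E n := by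
    intro n hn
    induction n, hn using Nat.le_induction with
    | base =>
      intro _
      have h1 : u N ≤ |u N| / a N * C * E N := by
        calc u N ≤ |u N| / a N * a N := by rw [div_mul_cancel₀ _ (ha N).ne']; exact le_abs_self _
          _ ≤ |u N| / a N * (C * E N) :=
            mul_le_mul_of_nonneg_left (haE N le_rfl hm) (div_nonneg (abs_nonneg _) (ha N).le)
          _ = _ := by ring
      have h2 := (le_abs_self _).trans (hpE N le_rfl)
      have h3 := mul_le_mul_of_nonneg_right
        (le_max_left (|u N| / a N * C + C * (S * C)) (C₁ / (l - ρ))) (hE0 N)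
      rw [← hB] at h3
      linarith
    | succ n hn ih =>
      intro hnm
      have hnm' : n < m := hnm
      have hW := ih hnm'.le
      have hpn : p n = a n * c n n + ∑ i ∈ Finset.Ico (n + 1) m, a i * c n i :=
        Finset.sum_eq_sum_Ico_succ_bot hnm' _
      have hdiff : p (n + 1) - ∑ i ∈ Finset.Ico (n + 1) m, a i * c n i
          ≤ C * α (n + 1) * (a n + e n) := by
        rw [hp, ← Finset.sum_sub_distrib, hα]
        simp only
        rw [Finset.mul_sum, Finset.sum_mul]
        refine Finset.sum_le_sum fun i hi => ?_
        have h1 := (le_abs_self _).trans (hdc n i hn (Finset.mem_Ico.1 hi).1)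
        calc a i * c (n + 1) i - a i * c n i = a i * (c (n + 1) i - c n i) := by ring
          _ ≤ a i * (C * φ (i - (n + 1)) * (a n + e n)) :=
            mul_le_mul_of_nonneg_left h1 (ha i).le
          _ = _ := by ring
      -- The perturbation's change on exit is absorbed by the term `-κ * e n` of the recursion.
      have h1 : C * α (n + 1) * e n ≤ κ * e n :=
        mul_le_mul_of_nonneg_right ((mul_le_mul_of_nonneg_left (hαA (n + 1) (by omega)) hC).trans
          hsmall) (he n)
      have h2 : C * α (n + 1) * a n ≤ C * (S * C) * E n * a n := by
        refine mul_le_mul_of_nonneg_right ?_ (ha n).le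
        calc C * α (n + 1) ≤ C * (C * E (n + 1) * S) :=
              mul_le_mul_of_nonneg_left (hαE (n + 1) (by omega)) hC
          _ ≤ C * (C * E n * S) := by gcongr; exact hEanti (by omega)
          _ = _ := by ring
      have h3 : l * a n * -p n ≥ - (l * (C * (S * C)) * E n * a n) := by
        have h4 := (le_abs_self _).trans (hpE n hn)
        have h5 : 0 ≤ l * a n := mul_nonneg (by linarith) (ha n).le
        nlinarith [mul_le_mul_of_nonneg_left h4 h5]
      have h4 : C * a n ^ 2 ≤ C * C * E n * a n := by
        have := mul_le_mul_of_nonneg_left (haE n hn hnm'.le) (mul_nonneg hC (ha n).le)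
        nlinarith
      have h5 : (1 - l * a n) * (u n + p n) ≤ (1 - l * a n) * (B * E n) :=
        mul_le_mul_of_nonneg_left hW (by linarith [hstep n hn])
      -- The term `a n * c n n` has cancelled. The three summands of `C₁` come from damping the
      -- perturbation, from the quadratic error and from the drift of the covariances.
      have h6 : u (n + 1) + p (n + 1) ≤ (1 - l * a n) * (B * E n) + C₁ * E n * a n := by
        have h7 := hrec n hn
        rw [hC₁]
        nlinarith
      have h7 : C₁ ≤ B * (l - ρ) := (div_le_iff₀ hgap).1 (le_max_right _ _)
      -- The envelope contracts no faster than rate ρ, and the sum `u + p` contracts at rate l > ρ.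
      have h8 : (1 - ρ * a n) * E n ≤ E (n + 1) := by
        have h9 := Real.add_one_le_exp (-(ρ * a n))
        have h10 : E (n + 1) = Real.exp (-(ρ * a n)) * E n := by
          rw [hE]
          simp only
          rw [interpTime_succ, ← mul_assoc, ← Real.exp_add]
          congr 2
          ring
        rw [h10]
        exact mul_le_mul_of_nonneg_right (by linarith) (hE0 n)
      have h9 : C₁ * E n * a n ≤ B * (l - ρ) * E n * a n := by
        have := mul_nonneg (hE0 n) (ha n).le
        nlinarith
      have h10 := mul_le_mul_of_nonneg_left h8 hB0
      nlinarith
  have := key m hm le_rfl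
  simpa [hp, hE] using this

/-- For bounded noise only summability of the coefficients themselves is needed. Terms with a
summable power are eventually at most 1, where f ≤ f^θ. -/
theorem summable_toReal_of_tsum_rpow_ne_top {f : ℕ → ℝ≥0∞} {θ : ℝ} (hθ : 0 < θ) (hθ1 : θ ≤ 1)
    (hf : ∑' k, f k ^ θ ≠ ∞) : (∀ k, f k ≠ ∞) ∧ Summable fun k => (f k).toReal := by
  have hfin : ∀ k, f k ≠ ∞ := fun k hk => by
    have h1 := ENNReal.ne_top_of_tsum_ne_top hf k
    rw [hk, ENNReal.top_rpow_of_pos hθ] at h1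
    exact h1 rfl
  refine ⟨hfin, ?_⟩
  have hsum := ENNReal.summable_toReal hf
  refine hsum.of_norm_bounded_eventually_nat ?_
  have h0 : Tendsto (fun k => f k ^ θ) atTop (𝓝 0) := by
    rw [← Nat.cofinite_eq_atTop]; exact ENNReal.tendsto_cofinite_zero_of_tsum_ne_top hf
  filter_upwards [h0.eventually (gt_mem_nhds one_pos)] with k hk
  rw [Real.norm_of_nonneg ENNReal.toReal_nonneg]
  refine ENNReal.toReal_mono (ENNReal.ne_top_of_tsum_ne_top hf k) ?_
  have h1 : f k ≤ 1 := by
    by_contra hlt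
    push Not at hlt
    exact absurd hk (not_lt.2 (ENNReal.one_le_rpow hlt.le hθ))
  calc f k = f k ^ (1 : ℝ) := (ENNReal.rpow_one _).symm
    _ ≤ f k ^ θ := ENNReal.rpow_le_rpow_of_exponent_ge h1 hθ1

/-! ### Covariance inequalities under uniform mixing -/

section Covariance

variable {Ω : Type*} {m : MeasurableSpace Ω} [mΩ : MeasurableSpace Ω] {μ : Measure Ω}

/-- Covariance bound for events: if `P(A | m)` is uniformly close to `P(A)`, then `A` is almost
uncorrelated with `m`-measurable variables. -/
theorem abs_integral_indicator_sub_le [IsProbabilityMeasure μ]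
    (hm : m ≤ mΩ) {W : Ω → ℝ} (hW : StronglyMeasurable[m] W)
    (hWi : Integrable W μ) {A : Set Ω} (hA : MeasurableSet A) {p : ℝ}
    (hp : ∀ᵐ ω ∂μ, |condProb μ m A ω - μ.real A| ≤ p) :
    |∫ ω, W ω * A.indicator (fun _ => (1 : ℝ)) ω ∂μ - (∫ ω, W ω ∂μ) * μ.real A|
      ≤ p * ∫ ω, |W ω| ∂μ := by
  have hind : Integrable (A.indicator (fun _ => (1 : ℝ))) μ := (integrable_const 1).indicator hA
  have hWA : Integrable (W * A.indicator (fun _ => (1 : ℝ))) μ := by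
    refine hWi.mul_bdd (c := 1) hind.aestronglyMeasurable (Eventually.of_forall fun ω => ?_)
    by_cases h : ω ∈ A <;> simp [h]
  have h1 : ∫ ω, W ω * A.indicator (fun _ => (1 : ℝ)) ω ∂μ = ∫ ω, W ω * condProb μ m A ω ∂μ := by
    rw [← integral_condExp hm (f := fun ω => W ω * A.indicator (fun _ => (1 : ℝ)) ω)]
    exact integral_congr_ae (condExp_mul_of_stronglyMeasurable_left hW hWA hind)
  have hWc : Integrable (fun ω => W ω * condProb μ m A ω) μ :=
    (integrable_condExp (m := m) (f := W * A.indicator (fun _ => (1 : ℝ))) (μ := μ)).congr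
      (condExp_mul_of_stronglyMeasurable_left hW hWA hind)
  rw [h1, ← integral_mul_const, ← integral_sub hWc (hWi.mul_const _), ← integral_const_mul]
  refine (abs_integral_le_integral_abs).trans (integral_mono_ae ?_ (hWi.abs.const_mul p) ?_)
  · exact (hWc.sub (hWi.mul_const _)).abs
  · filter_upwards [hp] with ω hω
    rw [← mul_sub, abs_mul, mul_comm]
    gcongr

/-- Layer cake formula for a covariance with a bounded nonnegative variable. -/
theorem integral_mul_eq_integral_indicator [IsProbabilityMeasure μ] {W Y : Ω → ℝ}
    (hWi : Integrable W μ) (hY : Measurable Y) {L : ℝ} (hY0 : ∀ ω, 0 ≤ Y ω) (hYL : ∀ ω, Y ω ≤ L) :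
    IntegrableOn (fun s => ∫ ω, W ω * {ω | s < Y ω}.indicator (fun _ => (1 : ℝ)) ω ∂μ)
      (Set.Ioc 0 L) ∧
    ∫ ω, W ω * Y ω ∂μ =
      ∫ s in Set.Ioc 0 L, ∫ ω, W ω * {ω | s < Y ω}.indicator (fun _ => (1 : ℝ)) ω ∂μ := by
  have hmeas : MeasurableSet {p : Ω × ℝ | p.2 < Y p.1} :=
    measurableSet_lt measurable_snd (hY.comp measurable_fst)
  have hint : Integrable (Function.uncurry fun ω (s : ℝ) =>
      W ω * {ω | s < Y ω}.indicator (fun _ => (1 : ℝ)) ω)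
      (μ.prod (volume.restrict (Set.Ioc 0 L))) := by
    have h1 : Integrable (fun p : Ω × ℝ => W p.1) (μ.prod (volume.restrict (Set.Ioc 0 L))) :=
      hWi.comp_fst _
    have h2 : Integrable (fun p : Ω × ℝ => W p.1 *
        {p : Ω × ℝ | p.2 < Y p.1}.indicator (fun _ => (1 : ℝ)) p)
        (μ.prod (volume.restrict (Set.Ioc 0 L))) := by
      refine h1.mul_bdd (c := 1) ?_ (Eventually.of_forall fun p => ?_)
      · exact (measurable_const.indicator hmeas).aestronglyMeasurable
      · by_cases h : p ∈ {p : Ω × ℝ | p.2 < Y p.1} <;> simp [h]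
    refine h2.congr (Eventually.of_forall fun p => ?_)
    simp [Function.uncurry, Set.indicator]
  refine ⟨hint.integral_prod_right, ?_⟩
  rw [← integral_integral_swap hint]
  refine integral_congr_ae (Eventually.of_forall fun ω => ?_)
  simp only
  rw [integral_const_mul]
  congr 1
  have h3 : (fun s : ℝ => {ω | s < Y ω}.indicator (fun _ => (1 : ℝ)) ω)
      = (Set.Iio (Y ω)).indicator (fun _ => (1 : ℝ)) := by
    ext s; simp [Set.indicator]
  rw [h3, integral_indicator measurableSet_Iio, Measure.restrict_restrict measurableSet_Iio]
  have h4 : (Set.Iio (Y ω) ∩ Set.Ioc 0 L) = Set.Ioo 0 (Y ω) := by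
    ext s
    simp only [Set.mem_inter_iff, Set.mem_Iio, Set.mem_Ioc, Set.mem_Ioo]
    constructor
    · rintro ⟨h5, h6, h7⟩; exact ⟨h6, h5⟩
    · rintro ⟨h5, h6⟩; exact ⟨h6, h5, h6.le.trans (hYL ω)⟩
  rw [h4]
  simp [hY0 ω]

/-- Covariance inequality under uniform mixing: an `m`-measurable variable and a bounded centred
variable `Y`, all of whose upper level sets have conditional probability given `m` uniformly
close to the unconditional one. -/
theorem abs_integral_mul_le [IsProbabilityMeasure μ]
    (hm : m ≤ mΩ) {W : Ω → ℝ} (hW : StronglyMeasurable[m] W)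
    (hWi : Integrable W μ) {Y : Ω → ℝ} (hY : Measurable Y) {M : ℝ} (hYM : ∀ ω, |Y ω| ≤ M)
    (hY0 : ∫ ω, Y ω ∂μ = 0) {p : ℝ}
    (hp : ∀ s : ℝ, ∀ᵐ ω ∂μ, |condProb μ m {ω | s < Y ω} ω - μ.real {ω | s < Y ω}| ≤ p) :
    |∫ ω, W ω * Y ω ∂μ| ≤ 2 * M * p * ∫ ω, |W ω| ∂μ := by
  have hM : 0 ≤ M := by
    obtain ⟨ω⟩ := μ.nonempty_of_neZero
    exact (abs_nonneg _).trans (hYM ω)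
  have hYi : Integrable Y μ :=
    Integrable.of_bound hY.aestronglyMeasurable M (Eventually.of_forall fun ω => hYM ω)
  have hWY : Integrable (fun ω => W ω * Y ω) μ :=
    hWi.mul_bdd (c := M) hY.aestronglyMeasurable (Eventually.of_forall fun ω => hYM ω)
  have hY1 : Measurable fun ω => Y ω + M := hY.add_const M
  have hb0 : ∀ ω, 0 ≤ Y ω + M := fun ω => by linarith [(abs_le.1 (hYM ω)).1]
  have hbL : ∀ ω, Y ω + M ≤ 2 * M := fun ω => by linarith [(abs_le.1 (hYM ω)).2]
  obtain ⟨hi1, h1⟩ := integral_mul_eq_integral_indicator hWi hY1 hb0 hbL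
  -- The same formula with weight 1 writes E[Y + M] over the same levels. Since Y is centred, E[WY]
  -- is then an integral of event covariances over an interval of length 2M.
  obtain ⟨hi2, h2⟩ := integral_mul_eq_integral_indicator (μ := μ) (W := fun _ => 1)
    (integrable_const 1) hY1 hb0 hbL
  have h3 : ∫ ω, W ω * Y ω ∂μ = ∫ ω, W ω * (Y ω + M) ∂μ
      - (∫ ω, W ω ∂μ) * ∫ ω, (1 : ℝ) * (Y ω + M) ∂μ := by
    simp_rw [mul_add, one_mul]
    rw [integral_add hWY (hWi.mul_const M), integral_add hYi (integrable_const M), hY0,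
      integral_mul_const]
    simp
  rw [h3, h1, h2, ← integral_const_mul, ← integral_sub hi1 (hi2.const_mul _)]
  have hvol : volume.real (Set.Ioc 0 (2 * M)) = 2 * M := by simp [hM]
  have hbd := norm_setIntegral_le_of_norm_le_const (μ := volume) (s := Set.Ioc 0 (2 * M))
    (C := p * ∫ ω, |W ω| ∂μ)
    (f := fun s => ∫ ω, W ω * {ω | s < Y ω + M}.indicator (fun _ => (1 : ℝ)) ω ∂μ
      - (∫ ω, W ω ∂μ) * ∫ ω, 1 * {ω | s < Y ω + M}.indicator (fun _ => (1 : ℝ)) ω ∂μ)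
    measure_Ioc_lt_top (fun s _ => ?_)
  · rw [Real.norm_eq_abs, hvol] at hbd
    refine hbd.trans (le_of_eq (by ring))
  · have hset : {ω | s < Y ω + M} = {ω | s - M < Y ω} := by
      ext ω; simp [sub_lt_iff_lt_add]
    have hA : MeasurableSet {ω | s - M < Y ω} := measurableSet_lt measurable_const hY
    have h5 : ∫ ω, 1 * {ω | s < Y ω + M}.indicator (fun _ => (1 : ℝ)) ω ∂μ
        = μ.real {ω | s - M < Y ω} := by
      simp_rw [one_mul]
      rw [hset]
      exact integral_indicator_one hA
    rw [h5, hset]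
    exact abs_integral_indicator_sub_le hm hW hWi hA (hp (s - M))

end Covariance

/-! ### Passing from the noise history to the joint history -/

theorem comap_le_pastAlg {Ω S : Type*} [MeasurableSpace S] (Y : ℕ → Ω → S) {j n : ℕ}
    (h : j ≤ n) : MeasurableSpace.comap (Y j) inferInstance ≤ pastAlg Y n :=
  le_iSup₂_of_le j h le_rfl

theorem comap_le_futureAlg {Ω S : Type*} [MeasurableSpace S] (Y : ℕ → Ω → S) {j n : ℕ}
    (h : n ≤ j) : MeasurableSpace.comap (Y j) inferInstance ≤ futureAlg Y n :=
  le_iSup₂_of_le j h le_rfl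

theorem pastAlg_le {Ω S : Type*} [mΩ : MeasurableSpace Ω] [MeasurableSpace S] {Y : ℕ → Ω → S}
    (hY : ∀ n, Measurable (Y n)) (n : ℕ) : pastAlg Y n ≤ mΩ :=
  iSup₂_le fun j _ => (hY j).comap_le

/-- Covariance of a variable depending on the history of noise and state with a later centred
scalar observation of the noise. -/
theorem Exogenous.abs_integral_mul_le {Ω Ξ S T : Type*} [mΩ : MeasurableSpace Ω]
    [MeasurableSpace Ξ] [MeasurableSpace S] [MeasurableSpace T] {μ : Measure Ω}
    [IsProbabilityMeasure μ] {ξ : ℕ → Ω → Ξ} {X : ℕ → Ω → S} (hexo : Exogenous μ ξ X)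
    (hξ : ∀ n, Measurable (ξ n)) (hX : ∀ n, Measurable (X n))
    {f : Ξ → T} (hf : Measurable f) {g : T → ℝ} (hg : Measurable g) {M : ℝ}
    (hM : ∀ z, |g (f z)| ≤ M) {i k : ℕ} (hki : k < i)
    (h0 : ∫ ω, g (f (ξ i ω)) ∂μ = 0)
    (hmix : mixCoeff μ ξ (fun n ω => f (ξ n ω)) (i - k) ≠ ∞) {W : Ω → ℝ}
    (hW : StronglyMeasurable[pastAlg ξ k ⊔ pastAlg X k] W) (hWi : Integrable W μ) :
    |∫ ω, W ω * g (f (ξ i ω)) ∂μ|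
      ≤ 2 * M * (mixCoeff μ ξ (fun n ω => f (ξ n ω)) (i - k)).toReal * ∫ ω, |W ω| ∂μ := by
  have hm : pastAlg ξ k ⊔ pastAlg X k ≤ mΩ := sup_le (pastAlg_le hξ k) (pastAlg_le hX k)
  refine StochApprox.abs_integral_mul_le (Y := fun ω => g (f (ξ i ω))) hm hW hWi
    ((hg.comp hf).comp (hξ i))
    (fun ω => hM _) h0 fun s => ?_
  have hA1 : MeasurableSet[futureAlg (fun n ω => f (ξ n ω)) (k + (i - k))]
      {ω | s < g (f (ξ i ω))} := by
    refine comap_le_futureAlg (fun n ω => f (ξ n ω)) (j := i) (by omega) _ ?_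
    exact ⟨{y | s < g y}, measurableSet_lt measurable_const hg, rfl⟩
  -- The strict inequality k < i enters here: exogeneity concerns only noise after time `k`.
  have hA2 : MeasurableSet[futureAlg ξ (k + 1)] {ω | s < g (f (ξ i ω))} := by
    refine comap_le_futureAlg ξ (j := i) (by omega) _ ?_
    exact ⟨{y | s < g (f y)}, measurableSet_lt measurable_const (hg.comp hf), rfl⟩
  have hle : eLpNorm (fun ω => condProb μ (pastAlg ξ k) {ω | s < g (f (ξ i ω))} ω
      - μ.real {ω | s < g (f (ξ i ω))}) ∞ μ ≤ mixCoeff μ ξ (fun n ω => f (ξ n ω)) (i - k) :=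
    le_iSup_of_le k (le_iSup₂_of_le (f := fun (A : Set Ω)
      (_ : MeasurableSet[futureAlg (fun n ω => f (ξ n ω)) (k + (i - k))] A) =>
      eLpNorm (fun ω => condProb μ (pastAlg ξ k) A ω - μ.real A) ∞ μ) _ hA1 le_rfl)
  rw [eLpNorm_exponent_top] at hle
  filter_upwards [hexo k _ hA2, ae_le_eLpNormEssSup (μ := μ) (f := fun ω => condProb μ (pastAlg ξ k)
    {ω | s < g (f (ξ i ω))} ω - μ.real {ω | s < g (f (ξ i ω))})] with ω h1 h2
  rw [h1]
  have h3 := ENNReal.toReal_mono hmix (h2.trans hle)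
  simpa using h3

/-! ### The recursion stopped on leaving a ball -/

section Localization

variable {Ω E : Type*} [NormedAddCommGroup E]

/-- The event that `X` stays in the closed ball of radius `δ` about `x` from time `N` to `n`. -/
def staySet (X : ℕ → Ω → E) (x : E) (δ : ℝ) (N n : ℕ) : Set Ω :=
  {ω | ∀ k, N ≤ k → k ≤ n → X k ω ∈ Metric.closedBall x δ}

theorem staySet_eq_iInter (X : ℕ → Ω → E) (x : E) (δ : ℝ) (N n : ℕ) :
    staySet X x δ N n = ⋂ k ∈ Finset.Icc N n, X k ⁻¹' Metric.closedBall x δ := by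
  ext ω
  simp [staySet]

theorem staySet_succ_subset (X : ℕ → Ω → E) (x : E) (δ : ℝ) (N n : ℕ) :
    staySet X x δ N (n + 1) ⊆ staySet X x δ N n :=
  fun _ h k h1 h2 => h k h1 (by omega)

theorem measurableSet_staySet [MeasurableSpace E] [BorelSpace E] {m : MeasurableSpace Ω}
    {X : ℕ → Ω → E} {n : ℕ} (hX : ∀ j ≤ n, Measurable[m] (X j)) (x : E) (δ : ℝ) (N : ℕ) :
    MeasurableSet[m] (staySet X x δ N n) := by
  rw [staySet_eq_iInter]
  exact Finset.measurableSet_biInter _ fun k hk =>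
    hX k (Finset.mem_Icc.1 hk).2 Metric.isClosed_closedBall.measurableSet

/-- Localized second-moment bound for a recursion with a Lyapunov function `V` and noise terms
`F α (X n) * Y α n` whose covariances with the past decay summably. -/
theorem exists_integral_indicator_le [mΩ : MeasurableSpace Ω] {μ : Measure Ω}
    [IsProbabilityMeasure μ] [MeasurableSpace E] [BorelSpace E] {ι : Type*} [Fintype ι]
    {X : ℕ → Ω → E} {𝓖 : ℕ → MeasurableSpace Ω} (h𝓖 : ∀ n, 𝓖 n ≤ mΩ)
    (hX : ∀ n, ∀ j ≤ n, Measurable[𝓖 n] (X j))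
    {a φ : ℕ → ℝ} (ha : ∀ n, 0 < a n) (ha0 : Tendsto a atTop (𝓝 0)) {ρ l : ℝ} (hρ : 0 ≤ ρ)
    (hρl : ρ < l) (hdec : DecreasesAtMost a ρ) (hφ0 : ∀ n, 0 ≤ φ n) (hφ : Summable φ)
    {V : E → ℝ} (hV : Continuous V) {F : ι → E → ℝ} (hF : ∀ α, Continuous (F α))
    {Y : ι → ℕ → Ω → ℝ} (hY : ∀ α n, Measurable (Y α n)) {M : ℝ} (hYM : ∀ α n ω, |Y α n ω| ≤ M)
    {C₀ : ℝ} (hC₀ : 0 ≤ C₀)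
    (hcov : ∀ α k i, k ≤ i → ∀ W : Ω → ℝ, StronglyMeasurable[𝓖 k] W → Integrable W μ →
      |∫ ω, W ω * Y α i ω ∂μ| ≤ C₀ * φ (i - k) * ∫ ω, |W ω| ∂μ)
    {x : E} {δ κ Bf L M₁ Vb C : ℝ} (hκ : 0 < κ) (hBf : 0 ≤ Bf) (hL : 0 ≤ L) (hM₁ : 0 ≤ M₁)
    (hC : 0 ≤ C)
    (hFb : ∀ α, ∀ y ∈ Metric.closedBall x δ, |F α y| ≤ Bf)
    (hFL : ∀ α, ∀ y ∈ Metric.closedBall x δ, ∀ z ∈ Metric.closedBall x δ,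
      |F α y - F α z| ≤ L * ‖y - z‖)
    (hVb : ∀ y ∈ Metric.closedBall x δ, |V y| ≤ Vb)
    {N₁ : ℕ}
    (hinc : ∀ n ω, N₁ ≤ n → X n ω ∈ Metric.closedBall x δ → ‖X (n + 1) ω - X n ω‖ ≤ M₁ * a n)
    (hdrift : ∀ n ω, N₁ ≤ n → X n ω ∈ Metric.closedBall x δ →
      V (X (n + 1) ω) ≤ (1 - l * a n) * V (X n ω) + a n * ∑ α, F α (X n ω) * Y α n ω
        + C * a n ^ 2)
    (hexit : ∀ n ω, N₁ ≤ n → X n ω ∈ Metric.closedBall x δ →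
      X (n + 1) ω ∉ Metric.closedBall x δ → κ ≤ V (X (n + 1) ω)) :
    ∃ N₀ : ℕ, ∀ N, N₀ ≤ N → ∃ B : ℝ, ∀ m, N ≤ m →
      ∫ ω, (staySet X x δ N m).indicator (fun ω => V (X m ω)) ω ∂μ ≤ B * a m := by
  obtain ⟨Cd, Nd, hdec⟩ := hdec
  set S : ℝ := ∑' k, φ k
  have hS : 0 ≤ S := tsum_nonneg hφ0
  set q : ℝ := (Fintype.card ι : ℝ) with hq
  have hq0 : 0 ≤ q := Nat.cast_nonneg _
  set C' : ℝ := C + |Cd| + q * C₀ * Bf + q * C₀ * (L * M₁) with hC'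
  have hb1 : 0 ≤ q * C₀ * Bf := by positivity
  have hb2 : 0 ≤ q * C₀ * (L * M₁) := by positivity
  have hC'0 : 0 ≤ C' := by positivity
  have hl0 : 0 < l := hρ.trans_lt hρl
  -- Below this step size, l a_n ≤ 1 and the perturbation is too small to offset the loss κ at exit.
  set A : ℝ := min l⁻¹ (κ / (C' * S + 1)) with hA
  have hA0 : 0 < A := lt_min (inv_pos.2 hl0) (by positivity)
  obtain ⟨N₂, hN₂⟩ := eventually_atTop.1 (ha0.eventually (gt_mem_nhds hA0))
  refine ⟨max N₁ (max N₂ Nd), fun N hN => ?_⟩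
  have hNN : N₁ ≤ N ∧ N₂ ≤ N ∧ Nd ≤ N := by simpa using hN
  obtain ⟨hN1, hN2, hNd⟩ := hNN
  set D : ℕ → Set Ω := fun n => staySet X x δ N n with hD
  have hDsub : ∀ n, D (n + 1) ⊆ D n := fun n => staySet_succ_subset X x δ N n
  have hDm' : ∀ n, MeasurableSet[𝓖 n] (D n) := fun n => measurableSet_staySet (hX n) x δ N
  have hDm : ∀ n, MeasurableSet (D n) := fun n => h𝓖 n _ (hDm' n)
  have hXm : ∀ n, Measurable (X n) := fun n => (hX n n le_rfl).mono (h𝓖 n) le_rfl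
  have hDball : ∀ n ω, N ≤ n → ω ∈ D n → X n ω ∈ Metric.closedBall x δ :=
    fun n ω hn h => h n hn le_rfl
  have hDexit : ∀ n ω, ω ∈ D n → ω ∉ D (n + 1) → X (n + 1) ω ∉ Metric.closedBall x δ := by
    intro n ω h1 h2 h3
    refine h2 fun k hk1 hk2 => ?_
    rcases Nat.lt_or_ge n k with h4 | h4
    · obtain rfl : k = n + 1 := by omega
      exact h3
    · exact h1 k hk1 h4
  set Z : ι → ℕ → Ω → ℝ := fun α n => (D n).indicator fun ω => F α (X n ω) with hZ
  have hZb : ∀ α n ω, N ≤ n → |Z α n ω| ≤ Bf := by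
    intro α n ω hn
    by_cases h : ω ∈ D n
    · simpa [hZ, h] using hFb α _ (hDball n ω hn h)
    · simpa [hZ, h] using hBf
  have hZs : ∀ α n k, n ≤ k → StronglyMeasurable[𝓖 k] (Z α n) := by
    intro α n k hnk
    have h1 : Measurable[𝓖 k] (fun ω => F α (X n ω)) := (hF α).measurable.comp (hX k n hnk)
    exact (h1.indicator
      (measurableSet_staySet (fun j hj => hX k j (hj.trans hnk)) x δ N)).stronglyMeasurable
  have hZi : ∀ α n, N ≤ n → Integrable (Z α n) μ := fun α n hn =>
    Integrable.of_bound ((hZs α n n le_rfl).mono (h𝓖 n)).aestronglyMeasurable Bf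
      (Eventually.of_forall fun ω => hZb α n ω hn)
  have hZYi : ∀ α n i, N ≤ n → Integrable (fun ω => Z α n ω * Y α i ω) μ := fun α n i hn =>
    (hZi α n hn).mul_bdd (c := M) (hY α i).aestronglyMeasurable
      (Eventually.of_forall fun ω => hYM α i ω)
  set e : ℕ → ℝ := fun n => μ.real (D n \ D (n + 1)) with he
  set u : ℕ → ℝ := fun n => ∫ ω, (D n).indicator (fun ω => V (X n ω)) ω ∂μ with hu
  set c : ℕ → ℕ → ℝ := fun n i => ∑ α, ∫ ω, Z α n ω * Y α i ω ∂μ with hc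
  have hind : ∀ n, Integrable ((D n \ D (n + 1)).indicator (fun _ => (1 : ℝ))) μ := fun n =>
    (integrable_const 1).indicator ((hDm n).diff (hDm (n + 1)))
  have hindi : ∀ n (r : ℝ),
      ∫ ω, r * (D n \ D (n + 1)).indicator (fun _ => (1 : ℝ)) ω ∂μ = r * e n := fun n r => by
    rw [integral_const_mul]
    congr 1
    exact integral_indicator_one ((hDm n).diff (hDm (n + 1)))
  have hVi : ∀ n, N ≤ n → Integrable ((D n).indicator (fun ω => V (X n ω))) μ := by
    intro n hn
    refine Integrable.of_bound
      ((hV.measurable.comp (hXm n)).indicator (hDm n)).aestronglyMeasurable |Vb|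
      (Eventually.of_forall fun ω => ?_)
    by_cases h : ω ∈ D n
    · simpa [h] using (hVb _ (hDball n ω hn h)).trans (le_abs_self _)
    · simp [h]
  refine perturbed_recursion_bound (u := u) (e := e) (c := c) (φ := φ) (l := l) (ρ := ρ) (C := C')
    (κ := κ) (S := S) (A := A) ha hC'0 hρ hρl hφ0 (fun s => hφ.sum_le_tsum s fun i _ => hφ0 i)
    (fun n => measureReal_nonneg) ?_ (fun n hn => (hN₂ n (hN2.trans hn)).le) ?_ ?_ ?_ ?_ ?_
  · intro n hn
    have h1 : a n ≤ l⁻¹ := (hN₂ n (hN2.trans hn)).le.trans (min_le_left _ _)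
    calc l * a n ≤ l * l⁻¹ := mul_le_mul_of_nonneg_left h1 hl0.le
      _ = 1 := mul_inv_cancel₀ hl0.ne'
  · have h1 : A ≤ κ / (C' * S + 1) := min_le_right _ _
    rw [le_div_iff₀ (by positivity)] at h1
    nlinarith
  · intro n hn
    -- On exit the left side vanishes although V(X_{n+1}) ≥ κ; this surplus produces the last term.
    have hpt : ∀ ω, (D (n + 1)).indicator (fun ω => V (X (n + 1) ω)) ω ≤
        (1 - l * a n) * (D n).indicator (fun ω => V (X n ω)) ω
          + a n * ∑ α, Z α n ω * Y α n ω + C' * a n ^ 2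
          - κ * (D n \ D (n + 1)).indicator (fun _ => (1 : ℝ)) ω := by
      intro ω
      have hCC : C * a n ^ 2 ≤ C' * a n ^ 2 :=
        mul_le_mul_of_nonneg_right (by rw [hC']; linarith [abs_nonneg Cd]) (sq_nonneg _)
      by_cases h : ω ∈ D n
      · have h1 := hdrift n ω (hN1.trans hn) (hDball n ω hn h)
        by_cases h' : ω ∈ D (n + 1)
        · simp only [hZ, Set.indicator_of_mem h, Set.indicator_of_mem h']
          rw [Set.indicator_of_notMem (fun h2 => h2.2 h')]
          linarith
        · have h2 := hexit n ω (hN1.trans hn) (hDball n ω hn h) (hDexit n ω h h')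
          simp only [hZ, Set.indicator_of_mem h, Set.indicator_of_notMem h']
          rw [Set.indicator_of_mem (show ω ∈ D n \ D (n + 1) from ⟨h, h'⟩)]
          linarith
      · have h' : ω ∉ D (n + 1) := fun h1 => h (hDsub n h1)
        simp only [hZ, Set.indicator_of_notMem h, Set.indicator_of_notMem h']
        rw [Set.indicator_of_notMem (fun h2 => h h2.1)]
        have : 0 ≤ C' * a n ^ 2 := by positivity
        simpa using this
    have hs : Integrable (fun ω => ∑ α, Z α n ω * Y α n ω) μ :=
      integrable_finsetSum _ fun α _ => hZYi α n n hn
    have i1 := (hVi n hn).const_mul (1 - l * a n)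
    have i2 := hs.const_mul (a n)
    have i3 : Integrable (fun _ : Ω => C' * a n ^ 2) μ := integrable_const _
    have i4 := (hind n).const_mul κ
    have h1 := integral_mono (hVi (n + 1) (by omega)) (((i1.add i2).add i3).sub i4) hpt
    refine h1.trans (le_of_eq ?_)
    rw [integral_sub' ((i1.add i2).add i3) i4, integral_add' (i1.add i2) i3, integral_add' i1 i2,
      integral_const_mul, integral_const_mul, hindi,
      integral_finsetSum _ fun α _ => hZYi α n n hn]
    simp [hu, hc]
  · intro n i hn hi
    calc |c n i| ≤ ∑ α, |∫ ω, Z α n ω * Y α i ω ∂μ| := Finset.abs_sum_le_sum_abs _ _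
      _ ≤ ∑ _α : ι, C₀ * φ (i - n) * Bf := by
          refine Finset.sum_le_sum fun α _ => (hcov α n i hi _ (hZs α n n le_rfl) (hZi α n hn)).trans ?_
          refine mul_le_mul_of_nonneg_left ?_ (mul_nonneg hC₀ (hφ0 _))
          calc ∫ ω, |Z α n ω| ∂μ ≤ ∫ _ω, Bf ∂μ :=
                integral_mono (hZi α n hn).abs (integrable_const _) fun ω => hZb α n ω hn
            _ = Bf := by simp
      _ = q * C₀ * Bf * φ (i - n) := by simp [hq]; ring
      _ ≤ C' * φ (i - n) := by
          refine mul_le_mul_of_nonneg_right ?_ (hφ0 _)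
          rw [hC']; linarith [abs_nonneg Cd]
  · intro n i hn hi
    have hn1 : N ≤ n + 1 := by omega
    -- A path that stays moves by O(a_n) and `F α` is Lipschitz; a path that exits loses a value of
    -- size at most `Bf`.
    have hdiff : ∀ α ω, |Z α (n + 1) ω - Z α n ω| ≤
        L * M₁ * a n + Bf * (D n \ D (n + 1)).indicator (fun _ => (1 : ℝ)) ω := by
      intro α ω
      have hpos : 0 ≤ L * M₁ * a n := by have := ha n; positivity
      by_cases h : ω ∈ D n
      · by_cases h' : ω ∈ D (n + 1)
        · simp only [hZ, Set.indicator_of_mem h, Set.indicator_of_mem h']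
          rw [Set.indicator_of_notMem (fun h2 => h2.2 h')]
          have h1 := hFL α _ (hDball (n + 1) ω hn1 h') _ (hDball n ω hn h)
          have h2 := mul_le_mul_of_nonneg_left
            (hinc n ω (hN1.trans hn) (hDball n ω hn h)) hL
          linarith
        · simp only [hZ, Set.indicator_of_mem h, Set.indicator_of_notMem h']
          rw [Set.indicator_of_mem (show ω ∈ D n \ D (n + 1) from ⟨h, h'⟩), zero_sub, abs_neg]
          linarith [hFb α _ (hDball n ω hn h)]
      · have h' : ω ∉ D (n + 1) := fun h1 => h (hDsub n h1)
        simp only [hZ, Set.indicator_of_notMem h, Set.indicator_of_notMem h']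
        rw [Set.indicator_of_notMem (fun h2 => h h2.1)]
        simpa using hpos
    have hint : ∀ α, ∫ ω, |Z α (n + 1) ω - Z α n ω| ∂μ ≤ L * M₁ * a n + Bf * e n := by
      intro α
      have i4 := (hind n).const_mul Bf
      have i3 : Integrable (fun _ : Ω => L * M₁ * a n) μ := integrable_const _
      have h1 := integral_mono ((hZi α (n + 1) hn1).sub (hZi α n hn)).abs (i3.add i4) (hdiff α)
      refine h1.trans (le_of_eq ?_)
      rw [integral_add' i3 i4, hindi]
      simp
    have he0 : 0 ≤ e n := measureReal_nonneg
    calc |c (n + 1) i - c n i|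
        = |∑ α, ∫ ω, (Z α (n + 1) ω - Z α n ω) * Y α i ω ∂μ| := by
          rw [hc, ← Finset.sum_sub_distrib]
          congr 1
          refine Finset.sum_congr rfl fun α _ => ?_
          rw [← integral_sub (hZYi α (n + 1) i hn1) (hZYi α n i hn)]
          simp_rw [sub_mul]
      _ ≤ ∑ α, |∫ ω, (Z α (n + 1) ω - Z α n ω) * Y α i ω ∂μ| := Finset.abs_sum_le_sum_abs _ _
      _ ≤ ∑ _α : ι, C₀ * φ (i - (n + 1)) * (L * M₁ * a n + Bf * e n) := by
          refine Finset.sum_le_sum fun α _ => (hcov α (n + 1) i hi _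
            ((hZs α (n + 1) (n + 1) le_rfl).sub (hZs α n (n + 1) (by omega)))
            ((hZi α (n + 1) hn1).sub (hZi α n hn))).trans ?_
          exact mul_le_mul_of_nonneg_left (hint α) (mul_nonneg hC₀ (hφ0 _))
      _ = φ (i - (n + 1)) * (q * C₀ * (L * M₁) * a n + q * C₀ * Bf * e n) := by simp [hq]; ring
      _ ≤ φ (i - (n + 1)) * (C' * a n + C' * e n) := by
          refine mul_le_mul_of_nonneg_left (add_le_add ?_ ?_) (hφ0 _)
          · refine mul_le_mul_of_nonneg_right ?_ (ha n).le
            rw [hC']; linarith [abs_nonneg Cd]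
          · refine mul_le_mul_of_nonneg_right ?_ he0
            rw [hC']; linarith [abs_nonneg Cd]
      _ = C' * φ (i - (n + 1)) * (a n + e n) := by ring
  · intro i m hi him
    refine (hdec i m (hNd.trans hi) him).trans ?_
    have h1 : Cd ≤ C' := by rw [hC']; linarith [le_abs_self Cd]
    have := (ha m).le
    gcongr

end Localization

/-! ### From localized moment bounds to tightness -/

/-- A sequence converging almost surely to `x` stays near `x` from a late time on with probability
close to one. -/
theorem tendsto_measureReal_exists_notMem {Ω E : Type*} [NormedAddCommGroup E]
    [MeasurableSpace E] [BorelSpace E] [MeasurableSpace Ω] {μ : Measure Ω}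
    [IsProbabilityMeasure μ] {X : ℕ → Ω → E} (hX : ∀ n, Measurable (X n)) {x : E} {δ : ℝ}
    (hδ : 0 < δ) (hlim : ∀ᵐ ω ∂μ, Tendsto (fun n => X n ω) atTop (𝓝 x)) :
    Tendsto (fun N => μ.real {ω | ∃ k, N ≤ k ∧ X k ω ∉ Metric.closedBall x δ}) atTop (𝓝 0) := by
  have hm : ∀ N, MeasurableSet {ω | ∃ k, N ≤ k ∧ X k ω ∉ Metric.closedBall x δ} := by
    intro N
    have : {ω | ∃ k, N ≤ k ∧ X k ω ∉ Metric.closedBall x δ}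
        = ⋃ k ∈ Set.Ici N, X k ⁻¹' (Metric.closedBall x δ)ᶜ := by
      ext ω; simp
    rw [this]
    exact MeasurableSet.biUnion (Set.to_countable _) fun k _ =>
      hX k Metric.isClosed_closedBall.measurableSet.compl
  have h1 := tendsto_measure_iInter_atTop (μ := μ) (fun N => (hm N).nullMeasurableSet)
    (fun N N' hNN ω ⟨k, hk, hkω⟩ => ⟨k, le_trans hNN hk, hkω⟩) ⟨0, measure_ne_top _ _⟩
  have h2 : μ (⋂ N, {ω | ∃ k, N ≤ k ∧ X k ω ∉ Metric.closedBall x δ}) = 0 := by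
    refine measure_mono_null (t := {ω | ¬ Tendsto (fun n => X n ω) atTop (𝓝 x)}) ?_ hlim
    intro ω hω hT
    obtain ⟨N, hN⟩ := eventually_atTop.1 (hT.eventually (Metric.closedBall_mem_nhds x hδ))
    obtain ⟨k, hk, hkω⟩ := Set.mem_iInter.1 hω N
    exact hkω (hN k hk)
  rw [h2] at h1
  exact (ENNReal.tendsto_toReal ENNReal.zero_ne_top).comp h1

/-- Tightness of the rescaled errors from localized second-moment bounds. -/
theorem isTightMeasureSet_of_localized_bound {Ω E : Type*} [NormedAddCommGroup E]
    [NormedSpace ℝ E] [FiniteDimensional ℝ E]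
    [MeasurableSpace E] [BorelSpace E] [MeasurableSpace Ω] {μ : Measure Ω}
    [IsProbabilityMeasure μ] {X : ℕ → Ω → E} (hX : ∀ n, Measurable (X n)) {x : E} {δ c Vb : ℝ}
    (hδ : 0 < δ) (hc : 0 < c) (hlim : ∀ᵐ ω ∂μ, Tendsto (fun n => X n ω) atTop (𝓝 x))
    {a : ℕ → ℝ} (ha : ∀ n, 0 < a n) {V : E → ℝ} (hVc : Continuous V) (hV0 : ∀ y, 0 ≤ V y)
    (hVb : ∀ y ∈ Metric.closedBall x δ, V y ≤ Vb)
    (hlb : ∀ y ∈ Metric.closedBall x δ, c * ‖y - x‖ ^ 2 ≤ V y)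
    (hbd : ∃ N₀ : ℕ, ∀ N, N₀ ≤ N → ∃ B : ℝ, ∀ m, N ≤ m →
      ∫ ω, (staySet X x δ N m).indicator (fun ω => V (X m ω)) ω ∂μ ≤ B * a m) :
    IsTightMeasureSet (Set.range fun n => μ.map (fun ω => (√(a n))⁻¹ • (X n ω - x))) := by
  have hmeas : ∀ n, Measurable (fun ω => (√(a n))⁻¹ • (X n ω - x)) := fun n =>
    ((hX n).sub_const x).const_smul _
  have hprob : ∀ n, IsProbabilityMeasure (μ.map (fun ω => (√(a n))⁻¹ • (X n ω - x))) := fun n =>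
    Measure.isProbabilityMeasure_map (hmeas n).aemeasurable
  -- The limsup criterion ignores finitely many laws, so `N` may depend on ε and the whole range is
  -- still tight.
  refine isTightMeasureSet_range_of_tendsto_limsup_measure_norm_gt ?_
  rw [ENNReal.tendsto_nhds_zero]
  intro ε hε
  obtain ⟨η, hη0, hηε⟩ := ENNReal.lt_iff_exists_nnreal_btwn.1 hε
  have hη : (0 : ℝ) < η := by exact_mod_cast hη0
  obtain ⟨N₀, hN₀⟩ := hbd
  obtain ⟨N, hN, hNη⟩ := ((eventually_ge_atTop N₀).and
    ((tendsto_measureReal_exists_notMem hX hδ hlim).eventually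
      (gt_mem_nhds (half_pos hη)))).exists
  obtain ⟨B, hB⟩ := hN₀ N hN
  have hB0 : 0 ≤ B := by
    have h1 := hB N le_rfl
    have h2 : 0 ≤ ∫ ω, (staySet X x δ N N).indicator (fun ω => V (X N ω)) ω ∂μ :=
      integral_nonneg fun ω => Set.indicator_nonneg (fun _ _ => hV0 _) _
    exact nonneg_of_mul_nonneg_left (h2.trans h1) (ha N)
  have hlarge : ∀ᶠ r : ℝ in atTop, B ≤ η / 2 * (c * r ^ 2) := by
    have : Tendsto (fun r : ℝ => (η : ℝ) / 2 * (c * r ^ 2)) atTop atTop :=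
      ((tendsto_pow_atTop two_ne_zero).const_mul_atTop hc).const_mul_atTop (half_pos hη)
    exact this.eventually_ge_atTop B
  filter_upwards [hlarge, eventually_gt_atTop 0] with r hr hr0
  refine le_trans ?_ hηε.le
  refine limsup_le_of_le (h := ?_)
  filter_upwards [eventually_ge_atTop N] with n hn
  rw [Measure.map_apply (hmeas n) (measurableSet_lt measurable_const measurable_norm)]
  set f : Ω → ℝ := (staySet X x δ N n).indicator (fun ω => V (X n ω)) with hf
  have hfi : Integrable f μ := by
    refine Integrable.of_bound ((hVc.measurable.comp (hX n)).indicator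
      (measurableSet_staySet (fun j _ => hX j) x δ N)).aestronglyMeasurable |Vb|
      (Eventually.of_forall fun ω => ?_)
    by_cases h : ω ∈ staySet X x δ N n
    · rw [hf, Set.indicator_of_mem h, Real.norm_of_nonneg (hV0 _)]
      exact (hVb _ (h n hn le_rfl)).trans (le_abs_self _)
    · simp [hf, h]
  have hmarkov := mul_meas_ge_le_integral_of_nonneg (μ := μ) (f := f)
    (Eventually.of_forall fun ω => Set.indicator_nonneg (fun _ _ => hV0 _) _) hfi (c * r ^ 2 * a n)
  have hpos : 0 < c * r ^ 2 := by positivity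
  have h1 : μ.real {ω | c * r ^ 2 * a n ≤ f ω} ≤ η / 2 := by
    have h2 := hmarkov.trans (hB n hn)
    have h3 : c * r ^ 2 * μ.real {ω | c * r ^ 2 * a n ≤ f ω} ≤ B := by
      refine le_of_mul_le_mul_right ?_ (ha n)
      linarith
    have h4 : c * r ^ 2 * μ.real {ω | c * r ^ 2 * a n ≤ f ω} ≤ c * r ^ 2 * (η / 2) := by linarith
    exact le_of_mul_le_mul_left h4 hpos
  have hsub : (fun ω => (√(a n))⁻¹ • (X n ω - x)) ⁻¹' {y | r < ‖y‖} ⊆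
      {ω | ∃ k, N ≤ k ∧ X k ω ∉ Metric.closedBall x δ} ∪ {ω | c * r ^ 2 * a n ≤ f ω} := by
    intro ω hω
    by_cases h : ∃ k, N ≤ k ∧ X k ω ∉ Metric.closedBall x δ
    · exact Or.inl h
    · push Not at h
      refine Or.inr ?_
      have hs : ω ∈ staySet X x δ N n := fun k hk _ => h k hk
      have h2 : r < ‖(√(a n))⁻¹ • (X n ω - x)‖ := hω
      have hsq : 0 < √(a n) := Real.sqrt_pos.2 (ha n)
      rw [norm_smul, norm_inv, Real.norm_of_nonneg hsq.le, lt_inv_mul_iff₀ hsq] at h2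
      have h3 : r ^ 2 * a n ≤ ‖X n ω - x‖ ^ 2 := by
        calc r ^ 2 * a n = (√(a n) * r) ^ 2 := by rw [mul_pow, Real.sq_sqrt (ha n).le]; ring
          _ ≤ _ := pow_le_pow_left₀ (by positivity) h2.le 2
      change c * r ^ 2 * a n ≤ f ω
      rw [hf, Set.indicator_of_mem hs]
      refine le_trans ?_ (hlb _ (h n hn))
      rw [mul_assoc]
      exact mul_le_mul_of_nonneg_left h3 hc.le
  have h5 : μ.real ((fun ω => (√(a n))⁻¹ • (X n ω - x)) ⁻¹' {y | r < ‖y‖}) ≤ η :=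
    (measureReal_mono hsub).trans ((measureReal_union_le _ _).trans (by linarith))
  rw [← ENNReal.ofReal_toReal (measure_ne_top μ _)]
  exact (ENNReal.ofReal_le_ofReal h5).trans_eq (by simp)

/-! ### Linearization and covariances of the noise -/

section Noise

variable {Ω Ξ : Type*} [MeasurableSpace Ω] [PseudoMetricSpace Ξ] [MeasurableSpace Ξ]
  {μ : Measure Ω}

variable {d : ℕ} {h : EuclideanSpace ℝ (Fin d) → Ξ → EuclideanSpace ℝ (Fin d)}
  {hbar : EuclideanSpace ℝ (Fin d) → EuclideanSpace ℝ (Fin d)} {ξ : ℕ → Ω → Ξ}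
  {xs : EuclideanSpace ℝ (Fin d)}

theorem NoiseCondition.fderiv_hbar (hn : NoiseCondition μ h hbar ξ xs) (n : ℕ)
    (x : EuclideanSpace ℝ (Fin d)) :
    ∫ ω, fderiv ℝ (fun y => h y (ξ n ω)) x ∂μ = fderiv ℝ hbar x :=
  (hn.mean_hx n x).fderiv.symm

theorem NoiseCondition.continuous_h_right (hn : NoiseCondition μ h hbar ξ xs)
    (x : EuclideanSpace ℝ (Fin d)) : Continuous (h x) :=
  hn.continuous_h.comp (Continuous.prodMk_right x)

theorem NoiseCondition.continuous_hx_right (hn : NoiseCondition μ h hbar ξ xs)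
    (x : EuclideanSpace ℝ (Fin d)) : Continuous fun z => fderiv ℝ (fun y => h y z) x :=
  hn.continuous_hx.comp (Continuous.prodMk_right x)

/-- The mixing coefficients of both centred noises are finite and summable. -/
theorem NoiseCondition.summable_mixCoeff (hn : NoiseCondition μ h hbar ξ xs) :
    ((∀ k, mixCoeff μ ξ (fun n ω => h xs (ξ n ω) - hbar xs) k ≠ ∞) ∧
      Summable fun k => (mixCoeff μ ξ (fun n ω => h xs (ξ n ω) - hbar xs) k).toReal) ∧
    ((∀ k, mixCoeff μ ξ
        (fun n ω => fderiv ℝ (fun y => h y (ξ n ω)) xs - fderiv ℝ hbar xs) k ≠ ∞) ∧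
      Summable fun k => (mixCoeff μ ξ
        (fun n ω => fderiv ℝ (fun y => h y (ξ n ω)) xs - fderiv ℝ hbar xs) k).toReal) := by
  obtain ⟨Δ, hΔ, h1, h2⟩ := hn.mixing
  have hθ : 0 < Δ / (1 + Δ) := by positivity
  have hθ1 : Δ / (1 + Δ) ≤ 1 := (div_le_one (by positivity)).2 (by linarith)
  exact ⟨summable_toReal_of_tsum_rpow_ne_top hθ hθ1 h1, summable_toReal_of_tsum_rpow_ne_top hθ hθ1 h2⟩

variable [BorelSpace Ξ] [IsProbabilityMeasure μ]

/-- Covariance of the history with a linear functional of a centred bounded function of the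
noise, with the same-time case included. -/
theorem Exogenous.abs_integral_mul_clm_le {T S : Type*} [NormedAddCommGroup T] [NormedSpace ℝ T]
    [FiniteDimensional ℝ T] [MeasurableSpace T] [BorelSpace T] [MeasurableSpace S]
    {ξ : ℕ → Ω → Ξ} {X : ℕ → Ω → S} (hexo : Exogenous μ ξ X)
    (hξ : ∀ n, Measurable (ξ n)) (hX : ∀ n, Measurable (X n)) {f : Ξ → T} (hf : Continuous f)
    {C : ℝ} (hC : ∀ z, ‖f z‖ ≤ C) {v : T} (hv : ∀ n, ∫ ω, f (ξ n ω) ∂μ = v) (g : T →L[ℝ] ℝ)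
    {M : ℝ} (hM : ∀ z, |g (f z - v)| ≤ M)
    (hmix : ∀ k, mixCoeff μ ξ (fun n ω => f (ξ n ω) - v) k ≠ ∞) {φ : ℕ → ℝ} (hφ0 : 1 ≤ φ 0)
    (hφ : ∀ k, (mixCoeff μ ξ (fun n ω => f (ξ n ω) - v) k).toReal ≤ φ k)
    {k i : ℕ} (hki : k ≤ i) {W : Ω → ℝ} (hW : StronglyMeasurable[pastAlg ξ k ⊔ pastAlg X k] W)
    (hWi : Integrable W μ) :
    |∫ ω, W ω * g (f (ξ i ω) - v) ∂μ| ≤ 2 * M * φ (i - k) * ∫ ω, |W ω| ∂μ := by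
  have hW0 : 0 ≤ ∫ ω, |W ω| ∂μ := integral_nonneg fun _ => abs_nonneg _
  have hfm : Measurable fun z => f z - v := (hf.measurable).sub_const v
  have hM0 : 0 ≤ M := by
    obtain ⟨ω⟩ := μ.nonempty_of_neZero
    exact (abs_nonneg _).trans (hM (ξ 0 ω))
  rcases hki.eq_or_lt with rfl | hlt
  -- At equal times there is no decorrelation; the trivial bound by M E|W| suffices because φ 0 ≥ 1.
  · have hYm : Measurable fun ω => g (f (ξ k ω) - v) :=
      g.continuous.measurable.comp (hfm.comp (hξ k))
    have hint : Integrable (fun ω => W ω * g (f (ξ k ω) - v)) μ :=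
      hWi.mul_bdd (c := M) hYm.aestronglyMeasurable (Eventually.of_forall fun ω => hM _)
    have h1 : ∫ ω, |W ω * g (f (ξ k ω) - v)| ∂μ ≤ ∫ ω, M * |W ω| ∂μ := by
      refine integral_mono hint.abs (hWi.abs.const_mul M) fun ω => ?_
      simp only
      rw [abs_mul, mul_comm]
      exact mul_le_mul_of_nonneg_right (hM _) (abs_nonneg _)
    rw [integral_const_mul] at h1
    refine (abs_integral_le_integral_abs.trans h1).trans (mul_le_mul_of_nonneg_right ?_ hW0)
    rw [Nat.sub_self]
    nlinarith
  · have hfi : Integrable (fun ω => f (ξ i ω)) μ :=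
      Integrable.of_bound (hf.measurable.comp (hξ i)).aestronglyMeasurable C
        (Eventually.of_forall fun ω => hC _)
    have h0 : ∫ ω, g (f (ξ i ω) - v) ∂μ = 0 := by
      have hfv : Integrable (fun ω => f (ξ i ω) - v) μ := hfi.sub (integrable_const v)
      rw [g.integral_comp_comm hfv, integral_sub hfi (integrable_const v), hv]
      simp
    refine (hexo.abs_integral_mul_le hξ hX hfm g.continuous.measurable hM hlt h0 (hmix _) hW
      hWi).trans (mul_le_mul_of_nonneg_right ?_ hW0)
    exact mul_le_mul_of_nonneg_left (hφ _) (by positivity)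

theorem NoiseCondition.integrable_h (hn : NoiseCondition μ h hbar ξ xs) (n : ℕ)
    (x : EuclideanSpace ℝ (Fin d)) : Integrable (fun ω => h x (ξ n ω)) μ := by
  obtain ⟨C, hC⟩ := hn.bounded_h ‖x‖
  exact Integrable.of_bound ((hn.continuous_h_right x).measurable.comp
    (hn.measurable_ξ n)).aestronglyMeasurable C (Eventually.of_forall fun ω => (hC x le_rfl _).1)

theorem NoiseCondition.integrable_hx (hn : NoiseCondition μ h hbar ξ xs) (n : ℕ)
    (x : EuclideanSpace ℝ (Fin d)) :
    Integrable (fun ω => fderiv ℝ (fun y => h y (ξ n ω)) x) μ := by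
  obtain ⟨C, hC⟩ := hn.bounded_h ‖x‖
  exact Integrable.of_bound ((hn.continuous_hx_right x).measurable.comp
    (hn.measurable_ξ n)).aestronglyMeasurable C (Eventually.of_forall fun ω => (hC x le_rfl _).2)

/-- The noise at `x` agrees with its linearization at `xs` up to a quadratic error. -/
theorem NoiseCondition.exists_norm_remainder_le (hn : NoiseCondition μ h hbar ξ xs) :
    ∃ C : ℝ, 0 ≤ C ∧ ∀ x ∈ Metric.closedBall xs 1, ∀ z,
      ‖h x z - hbar x - (h xs z - hbar xs)
        - (fderiv ℝ (fun y => h y z) xs - fderiv ℝ hbar xs) (x - xs)‖ ≤ C * ‖x - xs‖ ^ 2 := by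
  obtain ⟨C, hC⟩ := hn.bounded_hxx (‖xs‖ + 1)
  have hball : ∀ x ∈ Metric.closedBall xs 1, ‖x‖ ≤ ‖xs‖ + 1 := fun x hx => by
    have h1 := norm_le_norm_add_norm_sub' x xs
    have h2 := mem_closedBall_iff_norm.1 hx
    linarith
  have htaylor : ∀ x ∈ Metric.closedBall xs 1, ∀ z,
      ‖h x z - h xs z - fderiv ℝ (fun y => h y z) xs (x - xs)‖ ≤ C * ‖x - xs‖ ^ 2 :=
    fun x hx z => norm_taylor_le (hn.differentiable_h z) (hn.differentiable_hx z)
      (convex_closedBall xs 1) (fun y hy => hC y (hball y hy) z)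
      (Metric.mem_closedBall_self zero_le_one) hx
  refine ⟨2 * |C|, by positivity, fun x hx z => ?_⟩
  -- The Taylor remainder of `hbar` is the mean of that of `h`, so no second derivative of `hbar` is
  -- needed.
  have h1 : hbar x - hbar xs - fderiv ℝ hbar xs (x - xs)
      = ∫ ω, (h x (ξ 0 ω) - h xs (ξ 0 ω)
        - fderiv ℝ (fun y => h y (ξ 0 ω)) xs (x - xs)) ∂μ := by
    have i1 := hn.integrable_h 0 x
    have i2 := hn.integrable_h 0 xs
    have i3 := hn.integrable_hx 0 xs
    have i4 : Integrable (fun ω => h x (ξ 0 ω) - h xs (ξ 0 ω)) μ := i1.sub i2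
    rw [integral_sub i4 (i3.apply_continuousLinearMap _), integral_sub i1 i2,
      hn.mean_h, hn.mean_h, ← ContinuousLinearMap.integral_apply i3, hn.fderiv_hbar]
  have h2 : ‖hbar x - hbar xs - fderiv ℝ hbar xs (x - xs)‖ ≤ C * ‖x - xs‖ ^ 2 := by
    rw [h1]
    simpa using norm_integral_le_of_norm_le_const (μ := μ)
      (Eventually.of_forall fun ω => htaylor x hx (ξ 0 ω))
  have h3 : h x z - hbar x - (h xs z - hbar xs)
        - (fderiv ℝ (fun y => h y z) xs - fderiv ℝ hbar xs) (x - xs)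
      = (h x z - h xs z - fderiv ℝ (fun y => h y z) xs (x - xs))
        - (hbar x - hbar xs - fderiv ℝ hbar xs (x - xs)) := by
    rw [sub_apply]
    abel
  rw [h3]
  have h4 : C * ‖x - xs‖ ^ 2 ≤ |C| * ‖x - xs‖ ^ 2 :=
    mul_le_mul_of_nonneg_right (le_abs_self C) (sq_nonneg _)
  refine (norm_sub_le _ _).trans ?_
  linarith [htaylor x hx z]

end Noise

/-! ### Coordinate expansions and constants for the main proof -/

theorem clm_apply_eq_sum {d : ℕ} (A : EuclideanSpace ℝ (Fin d) →L[ℝ] ℝ)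
    (w : EuclideanSpace ℝ (Fin d)) :
    A w = ∑ j, A (EuclideanSpace.single j 1) * w j := by
  conv_lhs => rw [← (EuclideanSpace.basisFun (Fin d) ℝ).sum_repr w]
  simp [mul_comm]

/-- Separates state from noise: each summand is a scalar depending on `A` and `w` times a matrix
entry of `D`, the form to which scalar covariance bounds apply. -/
theorem clm_apply_clm_apply_eq_sum {d : ℕ} (A : EuclideanSpace ℝ (Fin d) →L[ℝ] ℝ)
    (D : EuclideanSpace ℝ (Fin d) →L[ℝ] EuclideanSpace ℝ (Fin d))
    (w : EuclideanSpace ℝ (Fin d)) :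
    A (D w) = ∑ p : Fin d × Fin d, A (EuclideanSpace.single p.1 1) * w p.2 *
      D (EuclideanSpace.single p.2 1) p.1 := by
  rw [clm_apply_eq_sum A, Fintype.sum_prod_type]
  refine Finset.sum_congr rfl fun j _ => ?_
  have h1 : (D w) j = ∑ k, D (EuclideanSpace.single k 1) j * w k :=
    clm_apply_eq_sum ((EuclideanSpace.proj j : EuclideanSpace ℝ (Fin d) →L[ℝ] ℝ).comp D) w
  rw [h1, Finset.mul_sum]
  exact Finset.sum_congr rfl fun k _ => by ring

/-- The Hessian bound is global, so the expansion also holds when the next iterate leaves the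
localization ball. -/
theorem IsLyapunov.exists_smoothness_bound {d : ℕ} {V : EuclideanSpace ℝ (Fin d) → ℝ}
    {F : EuclideanSpace ℝ (Fin d) → Set (EuclideanSpace ℝ (Fin d))}
    {xs : EuclideanSpace ℝ (Fin d)} {K c₀ lam : ℝ} (hV : IsLyapunov V F xs K c₀ lam) :
    ∃ H : ℝ, 0 ≤ H ∧ (∀ x y, V y ≤ V x + fderiv ℝ V x (y - x) + H * ‖y - x‖ ^ 2) ∧
      ∀ x y, ‖fderiv ℝ V y - fderiv ℝ V x‖ ≤ H * ‖y - x‖ := by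
  obtain ⟨H, hH⟩ := hV.hess_bounded
  have h1 : Differentiable ℝ V := hV.contDiff.differentiable (by norm_num)
  have h2 : Differentiable ℝ (fderiv ℝ V) :=
    (hV.contDiff.fderiv_right (m := 1) (by norm_num)).differentiable (by norm_num)
  refine ⟨H, le_trans (norm_nonneg (fderiv ℝ (fderiv ℝ V) xs)) (hH xs), fun x y => ?_,
    fun x y => ?_⟩
  · have h3 := norm_taylor_le h1 h2 convex_univ (fun z _ => hH z) (Set.mem_univ x) (Set.mem_univ y)
    linarith [(abs_le.1 ((Real.norm_eq_abs _).symm.trans_le h3)).2]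
  · exact convex_univ.norm_image_sub_le_of_norm_fderiv_le (fun z _ => h2 z) (fun z _ => hH z)
      (Set.mem_univ x) (Set.mem_univ y)

theorem IsLyapunov.exists_quadratic_lower {d : ℕ} {V : EuclideanSpace ℝ (Fin d) → ℝ}
    {F : EuclideanSpace ℝ (Fin d) → Set (EuclideanSpace ℝ (Fin d))}
    {xs : EuclideanSpace ℝ (Fin d)} {K c₀ lam : ℝ} (hV : IsLyapunov V F xs K c₀ lam)
    (hc₀ : 0 < c₀) :
    ∃ δ : ℝ, 0 < δ ∧ ∀ x ∈ Metric.closedBall xs δ, c₀ / 2 * ‖x - xs‖ ^ 2 ≤ V x := by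
  obtain ⟨r, hr, hle⟩ := hV.quadratic_lower
  obtain ⟨δ, hδ, h⟩ := Metric.nhds_basis_closedBall.eventually_iff.1
    ((hr.bound (half_pos hc₀)).and hle)
  refine ⟨δ, hδ, fun x hx => ?_⟩
  obtain ⟨h1, h2⟩ := h hx
  rw [Real.norm_eq_abs, Real.norm_of_nonneg (sq_nonneg _)] at h1
  linarith [(abs_le.1 h1).1]

theorem exists_decreasesAtMost {a : ℕ → ℝ} (ha : ∀ n, 0 < a n) {lam : ℝ} (hlam : 0 < lam)
    (hstep : ((∀ n : ℕ, 1 ≤ n → a n = 1 / (n : ℝ)) ∧ 1 < lam) ∨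
      (Tendsto a atTop (𝓝 0) ∧ SlowlyVarying a)) :
    Tendsto a atTop (𝓝 0) ∧ ∃ ρ, 0 ≤ ρ ∧ ρ < lam ∧ DecreasesAtMost a ρ := by
  rcases hstep with ⟨h1, h2⟩ | ⟨h1, h2⟩
  · refine ⟨?_, 1, zero_le_one, h2, decreasesAtMost_of_eq_one_div h1⟩
    refine tendsto_one_div_atTop_nhds_zero_nat.congr' ?_
    filter_upwards [eventually_ge_atTop 1] with n hn using (h1 n hn).symm
  · exact ⟨h1, lam / 2, by linarith, by linarith, h2.decreasesAtMost ha h1 (half_pos hlam)⟩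

end StochApprox

/-! ### The main theorem -/

open StochApprox

theorem proposition3p2 {d : ℕ} {Ω Ξ : Type*} [MeasurableSpace Ω]
    [PseudoMetricSpace Ξ] [MeasurableSpace Ξ] [BorelSpace Ξ]
    (μ : Measure Ω) [IsProbabilityMeasure μ]
    (a : ℕ → ℝ) (ha : ∀ n, 0 < a n)
    (h : EuclideanSpace ℝ (Fin d) → Ξ → EuclideanSpace ℝ (Fin d))
    (hbar : EuclideanSpace ℝ (Fin d) → EuclideanSpace ℝ (Fin d))
    (G : EuclideanSpace ℝ (Fin d) → Set (EuclideanSpace ℝ (Fin d)))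
    (b : ℕ → EuclideanSpace ℝ (Fin d) → EuclideanSpace ℝ (Fin d))
    (hb : ∀ n x, b n x ∈ G x)
    (ξ : ℕ → Ω → Ξ)
    (X : ℕ → Ω → EuclideanSpace ℝ (Fin d)) (hX : ∀ n, Measurable (X n))
    (halg : ∀ n ω, X (n + 1) ω = X n ω + a n • h (X n ω) (ξ n ω) + a n • b n (X n ω))
    (hexo : StochApprox.Exogenous μ ξ X)
    (xs : EuclideanSpace ℝ (Fin d))
    (hbdd : ∀ᵐ ω ∂μ, ∃ C : ℝ, ∀ n, ‖X n ω‖ ≤ C)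
    (hlim : ∀ᵐ ω ∂μ, Tendsto (fun n => X n ω) atTop (𝓝 xs))
    (hnoise : StochApprox.NoiseCondition μ h hbar ξ xs)
    (V : EuclideanSpace ℝ (Fin d) → ℝ) (K c₀ lam : ℝ) (hc₀ : 0 < c₀) (hlam : 0 < lam)
    (hV : StochApprox.IsLyapunov V (fun x => G x + {hbar x}) xs K c₀ lam)
    (hgrowth : ∀ n x z, ‖b n x‖ ^ 2 + ‖h x z‖ ^ 2 ≤ K * (1 + V x))
    (hstep : ((∀ n : ℕ, 1 ≤ n → a n = 1 / (n : ℝ)) ∧ 1 < lam) ∨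
      (Tendsto a atTop (𝓝 0) ∧ StochApprox.SlowlyVarying a)) :
    ∃ N : ℕ, IsTightMeasureSet
      {ν : Measure (EuclideanSpace ℝ (Fin d)) |
        ∃ n, N ≤ n ∧ ν = μ.map (fun ω => (√(a n))⁻¹ • (X n ω - xs))} := by
  obtain ⟨ha0, ρ, hρ, hρlam, hdec⟩ := exists_decreasesAtMost ha hlam hstep
  obtain ⟨H, hH0, hVtaylor, hVlip⟩ := hV.exists_smoothness_bound
  obtain ⟨δ₀, hδ₀, hVlow⟩ := hV.exists_quadratic_lower hc₀
  obtain ⟨R, hR0, hR⟩ := hnoise.exists_norm_remainder_le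
  obtain ⟨⟨hmix₁, hsum₁⟩, hmix₂, hsum₂⟩ := hnoise.summable_mixCoeff
  obtain ⟨Ch, hCh⟩ := hnoise.bounded_h ‖xs‖
  have hCh0 : 0 ≤ Ch := by
    obtain ⟨ω⟩ := μ.nonempty_of_neZero
    exact (norm_nonneg _).trans (hCh xs le_rfl (ξ 0 ω)).1
  have hbarb : ‖hbar xs‖ ≤ Ch := by
    rw [← hnoise.mean_h 0 xs]
    simpa using norm_integral_le_of_norm_le_const (μ := μ)
      (Eventually.of_forall fun ω => (hCh xs le_rfl (ξ 0 ω)).1)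
  have hbarxb : ‖fderiv ℝ hbar xs‖ ≤ Ch := by
    rw [← hnoise.fderiv_hbar 0 xs]
    simpa using norm_integral_le_of_norm_le_const (μ := μ)
      (Eventually.of_forall fun ω => (hCh xs le_rfl (ξ 0 ω)).2)
  have hVder : ∀ x, ‖fderiv ℝ V x‖ ≤ H * ‖x - xs‖ := fun x => by
    simpa [hV.fderiv_eq_zero] using hVlip xs x
  have hVc : Continuous V := hV.contDiff.continuous
  have hV'c : Continuous (fderiv ℝ V) := hV.contDiff.continuous_fderiv (by norm_num)
  -- Half of the gap λ - ρ stays as contraction beyond ρ and half absorbs the cubic remainder. In δ,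
  -- the bound δ₀/2 keeps a first exit point where the quadratic lower bound holds, and the last
  -- entry makes the remainder small enough.
  set l : ℝ := (lam + ρ) / 2 with hl
  set δ : ℝ := min (min 1 (δ₀ / 2)) (c₀ * (lam - ρ) / (4 * (H * R + 1))) with hδdef
  have hδ : 0 < δ := by
    refine lt_min (lt_min one_pos (by positivity)) (div_pos (mul_pos hc₀ (by linarith)) ?_)
    positivity
  have hδ1 : δ ≤ 1 := (min_le_left _ _).trans (min_le_left _ _)
  have hδδ₀ : δ ≤ δ₀ / 2 := (min_le_left _ _).trans (min_le_right _ _)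
  have hδR : H * R * δ ≤ c₀ / 2 * ((lam - ρ) / 2) := by
    have h1 : δ ≤ c₀ * (lam - ρ) / (4 * (H * R + 1)) := min_le_right _ _
    rw [le_div_iff₀ (by positivity)] at h1
    linarith
  have hnorm : ∀ x ∈ Metric.closedBall xs δ, ‖x - xs‖ ≤ δ := fun x hx =>
    mem_closedBall_iff_norm.1 hx
  have hVb : ∀ x ∈ Metric.closedBall xs δ, V x ≤ H := fun x hx => by
    have h1 := hVtaylor xs x
    rw [hV.zero, hV.fderiv_eq_zero] at h1
    have h2 : ‖x - xs‖ ^ 2 ≤ 1 :=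
      pow_le_one₀ (norm_nonneg _) ((hnorm x hx).trans hδ1)
    have h3 := mul_le_mul_of_nonneg_left h2 hH0
    simp only [zero_apply] at h1
    linarith
  set Q : ℝ := |K| * (1 + H) with hQ
  have hQ0 : 0 ≤ Q := by positivity
  set M₁ : ℝ := 2 * (Q + 1) with hM₁
  have hincr : ∀ n, ∀ x ∈ Metric.closedBall xs δ, ∀ z, ‖h x z + b n x‖ ≤ M₁ := by
    intro n x hx z
    have h1 : K * (1 + V x) ≤ Q := by
      have h2 : (0 : ℝ) ≤ 1 + V x := by linarith [hV.nonneg x]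
      calc K * (1 + V x) ≤ |K| * (1 + V x) := mul_le_mul_of_nonneg_right (le_abs_self K) h2
        _ ≤ _ := mul_le_mul_of_nonneg_left (by linarith [hVb x hx]) (abs_nonneg K)
    have h2 := hgrowth n x z
    have h3 := norm_add_le (h x z) (b n x)
    nlinarith [sq_nonneg (‖h x z‖ - 1), sq_nonneg (‖b n x‖ - 1)]
  have hdiff : ∀ n ω, X (n + 1) ω - X n ω = a n • (h (X n ω) (ξ n ω) + b n (X n ω)) :=
    fun n ω => by rw [halg, smul_add]; abel
  have hinc : ∀ n ω, X n ω ∈ Metric.closedBall xs δ → ‖X (n + 1) ω - X n ω‖ ≤ M₁ * a n := by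
    intro n ω hx
    rw [hdiff, norm_smul, Real.norm_of_nonneg (ha n).le, mul_comm]
    exact mul_le_mul_of_nonneg_right (hincr n _ hx _) (ha n).le
  have hMpos : 0 < M₁ := by positivity
  obtain ⟨N₁, hN₁⟩ := eventually_atTop.1 (ha0.eventually (gt_mem_nhds (div_pos hδ hMpos)))
  -- `F` and `Y` split DV(x)ψ_n + DV(x)ψ̃_n(x - x*) into products of a state scalar and a noise
  -- scalar: coordinates of ψ_n and matrix entries of ψ̃_n.
  let F : Fin d ⊕ Fin d × Fin d → EuclideanSpace ℝ (Fin d) → ℝ := Sum.elim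
    (fun j x => fderiv ℝ V x (EuclideanSpace.single j 1))
    (fun p x => fderiv ℝ V x (EuclideanSpace.single p.1 1) * (x - xs) p.2)
  let Y : Fin d ⊕ Fin d × Fin d → ℕ → Ω → ℝ := Sum.elim
    (fun j n ω => (h xs (ξ n ω) - hbar xs) j)
    (fun p n ω => (fderiv ℝ (fun y => h y (ξ n ω)) xs - fderiv ℝ hbar xs)
      (EuclideanSpace.single p.2 1) p.1)
  -- One sequence dominates both mixing coefficients; the extra 1 at k = 0 covers the same-time
  -- covariance.
  let φ : ℕ → ℝ := fun k => (mixCoeff μ ξ (fun n ω => h xs (ξ n ω) - hbar xs) k).toReal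
    + (mixCoeff μ ξ (fun n ω => fderiv ℝ (fun y => h y (ξ n ω)) xs - fderiv ℝ hbar xs) k).toReal
    + if k = 0 then 1 else 0
  have hcoord : ∀ (w : EuclideanSpace ℝ (Fin d)) j, |w j| ≤ ‖w‖ := fun w j =>
    (Real.norm_eq_abs _).symm.trans_le (PiLp.norm_apply_le w j)
  have hop : ∀ (A : EuclideanSpace ℝ (Fin d) →L[ℝ] ℝ) j,
      |A (EuclideanSpace.single j 1)| ≤ ‖A‖ := fun A j => by
    simpa using A.le_opNorm (EuclideanSpace.single j 1)
  have hF : ∀ α, Continuous (F α) := by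
    rintro (j | p)
    · exact hV'c.clm_apply continuous_const
    · exact (hV'c.clm_apply continuous_const).mul
        ((EuclideanSpace.proj p.2 : EuclideanSpace ℝ (Fin d) →L[ℝ] ℝ).continuous.comp
          (continuous_id.sub continuous_const))
  have hV'b : ∀ x ∈ Metric.closedBall xs δ, ‖fderiv ℝ V x‖ ≤ H := fun x hx =>
    (hVder x).trans (mul_le_of_le_one_right hH0 ((hnorm x hx).trans hδ1))
  have hFb : ∀ α, ∀ y ∈ Metric.closedBall xs δ, |F α y| ≤ H := by
    rintro (j | p) y hy
    · exact (hop _ j).trans (hV'b y hy)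
    · change |_ * _| ≤ _
      rw [abs_mul]
      have h1 := (hop (fderiv ℝ V y) p.1).trans (hV'b y hy)
      have h2 := (hcoord (y - xs) p.2).trans ((hnorm y hy).trans hδ1)
      calc _ ≤ H * 1 := mul_le_mul h1 h2 (abs_nonneg _) hH0
        _ = H := mul_one H
  have hFL : ∀ α, ∀ y ∈ Metric.closedBall xs δ, ∀ z ∈ Metric.closedBall xs δ,
      |F α y - F α z| ≤ 2 * H * ‖y - z‖ := by
    have h0 : ∀ y z (j : Fin d), |fderiv ℝ V y (EuclideanSpace.single j 1)
        - fderiv ℝ V z (EuclideanSpace.single j 1)| ≤ H * ‖y - z‖ := fun y z j =>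
      (hop (fderiv ℝ V y - fderiv ℝ V z) j).trans (hVlip z y)
    rintro (j | p) y hy z hz
    · refine (h0 y z j).trans ?_
      have := mul_nonneg hH0 (norm_nonneg (y - z))
      linarith
    · have h1 : F (Sum.inr p) y - F (Sum.inr p) z =
          (fderiv ℝ V y (EuclideanSpace.single p.1 1) - fderiv ℝ V z (EuclideanSpace.single p.1 1))
            * (y - xs) p.2 + fderiv ℝ V z (EuclideanSpace.single p.1 1) * (y - z) p.2 := by
        simp only [F, Sum.elim_inr, PiLp.sub_apply]
        ring
      have h2 := (hcoord (y - xs) p.2).trans ((hnorm y hy).trans hδ1)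
      have h3 := (hop (fderiv ℝ V z) p.1).trans (hV'b z hz)
      have h4 := hcoord (y - z) p.2
      rw [h1]
      refine (abs_add_le _ _).trans ?_
      rw [abs_mul, abs_mul]
      have h5 := mul_le_mul (h0 y z p.1) h2 (abs_nonneg _) (mul_nonneg hH0 (norm_nonneg _))
      have h6 := mul_le_mul h3 h4 (abs_nonneg _) hH0
      linarith
  have hψc : Continuous fun z => h xs z := hnoise.continuous_h_right xs
  have hψxc : Continuous fun z => fderiv ℝ (fun y => h y z) xs := hnoise.continuous_hx_right xs
  have hψb : ∀ z, ‖h xs z - hbar xs‖ ≤ 2 * Ch := fun z =>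
    (norm_sub_le _ _).trans (by linarith [(hCh xs le_rfl z).1])
  have hψxb : ∀ z, ‖fderiv ℝ (fun y => h y z) xs - fderiv ℝ hbar xs‖ ≤ 2 * Ch := fun z =>
    (norm_sub_le _ _).trans (by linarith [(hCh xs le_rfl z).2])
  let g₁ : Fin d → EuclideanSpace ℝ (Fin d) →L[ℝ] ℝ := fun j => EuclideanSpace.proj j
  let g₂ : Fin d × Fin d → (EuclideanSpace ℝ (Fin d) →L[ℝ] EuclideanSpace ℝ (Fin d)) →L[ℝ] ℝ :=
    fun p => (g₁ p.1).comp (ContinuousLinearMap.apply ℝ _ (EuclideanSpace.single p.2 1))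
  have hg₁ : ∀ j z, |g₁ j (h xs z - hbar xs)| ≤ 2 * Ch := fun j z =>
    (hcoord _ j).trans (hψb z)
  have hg₂ : ∀ p z, |g₂ p (fderiv ℝ (fun y => h y z) xs - fderiv ℝ hbar xs)| ≤ 2 * Ch :=
    fun p z => by
      refine (hcoord ((fderiv ℝ (fun y => h y z) xs - fderiv ℝ hbar xs)
        (EuclideanSpace.single p.2 1)) p.1).trans (le_trans ?_ (hψxb z))
      simpa using (fderiv ℝ (fun y => h y z) xs - fderiv ℝ hbar xs).le_opNorm
        (EuclideanSpace.single p.2 1)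
  have hY : ∀ α n, Measurable (Y α n) := by
    rintro (j | p) n
    · exact ((g₁ j).continuous.measurable.comp (hψc.measurable.sub_const (hbar xs))).comp
        (hnoise.measurable_ξ n)
    · exact ((g₂ p).continuous.measurable.comp (hψxc.measurable.sub_const (fderiv ℝ hbar xs))).comp
        (hnoise.measurable_ξ n)
  have hYM : ∀ α n ω, |Y α n ω| ≤ 2 * Ch := by
    rintro (j | p) n ω
    · exact hg₁ j _
    · exact hg₂ p _
  have hφ0 : ∀ k, 0 ≤ φ k := fun k => by
    simp only [φ]; positivity
  have hφ00 : 1 ≤ φ 0 := by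
    simp only [φ, if_true]
    have := ENNReal.toReal_nonneg (a := mixCoeff μ ξ (fun n ω => h xs (ξ n ω) - hbar xs) 0)
    have := ENNReal.toReal_nonneg (a := mixCoeff μ ξ
      (fun n ω => fderiv ℝ (fun y => h y (ξ n ω)) xs - fderiv ℝ hbar xs) 0)
    linarith
  have hite : ∀ k : ℕ, (0 : ℝ) ≤ if k = 0 then 1 else 0 := fun k => by positivity
  have hφs : Summable φ := (hsum₁.add hsum₂).add
    (summable_of_ne_finset_zero (s := {0}) fun k hk => by simpa using hk)
  have hcov : ∀ α k i, k ≤ i → ∀ W : Ω → ℝ, StronglyMeasurable[pastAlg ξ k ⊔ pastAlg X k] W →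
      Integrable W μ →
      |∫ ω, W ω * Y α i ω ∂μ| ≤ 2 * (2 * Ch) * φ (i - k) * ∫ ω, |W ω| ∂μ := by
    rintro (j | p) k i hki W hW hWi
    · refine hexo.abs_integral_mul_clm_le hnoise.measurable_ξ hX hψc
        (fun z => (hCh xs le_rfl z).1) (fun n => hnoise.mean_h n xs) (g₁ j) (hg₁ j) hmix₁ hφ00
        (fun k => ?_) hki hW hWi
      have := ENNReal.toReal_nonneg (a := mixCoeff μ ξ
        (fun n ω => fderiv ℝ (fun y => h y (ξ n ω)) xs - fderiv ℝ hbar xs) k)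
      simp only [φ]
      linarith [hite k]
    · refine hexo.abs_integral_mul_clm_le hnoise.measurable_ξ hX hψxc
        (fun z => (hCh xs le_rfl z).2) (fun n => hnoise.fderiv_hbar n xs) (g₂ p) (hg₂ p) hmix₂
        hφ00 (fun k => ?_) hki hW hWi
      have := ENNReal.toReal_nonneg (a := mixCoeff μ ξ (fun n ω => h xs (ξ n ω) - hbar xs) k)
      simp only [φ]
      linarith [hite k]
  have hdrift : ∀ n ω, N₁ ≤ n → X n ω ∈ Metric.closedBall xs δ →
      V (X (n + 1) ω) ≤ (1 - l * a n) * V (X n ω) + a n * ∑ α, F α (X n ω) * Y α n ω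
        + H * M₁ ^ 2 * a n ^ 2 := by
    intro n ω _ hx
    set x := X n ω with hxdef
    set z := ξ n ω with hzdef
    set A := fderiv ℝ V x with hA
    set w := h x z - hbar x - (h xs z - hbar xs)
        - (fderiv ℝ (fun y => h y z) xs - fderiv ℝ hbar xs) (x - xs) with hw
    have h1 := hVtaylor x (X (n + 1) ω)
    have h2 : H * ‖X (n + 1) ω - x‖ ^ 2 ≤ H * M₁ ^ 2 * a n ^ 2 := by
      rw [mul_assoc, ← mul_pow]
      exact mul_le_mul_of_nonneg_left (pow_le_pow_left₀ (norm_nonneg _) (hinc n ω hx) 2) hH0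
    have h3 : A (h x z + b n x) = A (b n x + hbar x) + A (h xs z - hbar xs)
        + A ((fderiv ℝ (fun y => h y z) xs - fderiv ℝ hbar xs) (x - xs)) + A w := by
      rw [← map_add, ← map_add, ← map_add]
      congr 1
      rw [hw]
      abel
    have h4 : A (h xs z - hbar xs)
        + A ((fderiv ℝ (fun y => h y z) xs - fderiv ℝ hbar xs) (x - xs))
        = ∑ α, F α x * Y α n ω := by
      rw [Fintype.sum_sum_type, clm_apply_eq_sum A, clm_apply_clm_apply_eq_sum A]
      rfl
    have h5 : A (b n x + hbar x) ≤ -lam * V x :=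
      hV.fderiv_le x _ (Set.add_mem_add (hb n x) rfl)
    -- DV vanishes linearly at x* and the noise remainder quadratically, so the product is at most
    -- HRδ|x - x*|².
    have h6 : A w ≤ (lam - ρ) / 2 * V x := by
      have hxδ := hnorm x hx
      have h7 : ‖w‖ ≤ R * ‖x - xs‖ ^ 2 := hR x (Metric.closedBall_subset_closedBall hδ1 hx) z
      have h8 : c₀ / 2 * ‖x - xs‖ ^ 2 ≤ V x :=
        hVlow x (Metric.closedBall_subset_closedBall (by linarith) hx)
      calc A w ≤ ‖A‖ * ‖w‖ := (le_abs_self _).trans (A.le_opNorm w)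
        _ ≤ H * ‖x - xs‖ * (R * ‖x - xs‖ ^ 2) :=
          mul_le_mul (hVder x) h7 (norm_nonneg _) (by positivity)
        _ = H * R * ‖x - xs‖ * ‖x - xs‖ ^ 2 := by ring
        _ ≤ H * R * δ * ‖x - xs‖ ^ 2 := by gcongr
        _ ≤ c₀ / 2 * ((lam - ρ) / 2) * ‖x - xs‖ ^ 2 := by gcongr
        _ = (lam - ρ) / 2 * (c₀ / 2 * ‖x - xs‖ ^ 2) := by ring
        _ ≤ _ := mul_le_mul_of_nonneg_left h8 (by linarith)
    have h7 : A (X (n + 1) ω - x) ≤ a n * (-l * V x + ∑ α, F α x * Y α n ω) := by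
      rw [hdiff, map_smul, smul_eq_mul]
      refine mul_le_mul_of_nonneg_left ?_ (ha n).le
      rw [h3, ← h4, hl]
      linarith
    linarith
  have hexit : ∀ n ω, N₁ ≤ n → X n ω ∈ Metric.closedBall xs δ →
      X (n + 1) ω ∉ Metric.closedBall xs δ → c₀ / 2 * δ ^ 2 ≤ V (X (n + 1) ω) := by
    intro n ω hn hx hx'
    have h1 : ‖X (n + 1) ω - X n ω‖ ≤ δ := by
      have h2 := (lt_div_iff₀ hMpos).1 (hN₁ n hn)
      linarith [hinc n ω hx]
    have h2 : δ ≤ ‖X (n + 1) ω - xs‖ := by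
      rw [mem_closedBall_iff_norm, not_le] at hx'
      exact hx'.le
    have h3 : X (n + 1) ω ∈ Metric.closedBall xs δ₀ := by
      rw [mem_closedBall_iff_norm]
      have h4 := norm_add_le (X (n + 1) ω - X n ω) (X n ω - xs)
      rw [sub_add_sub_cancel] at h4
      linarith [hnorm _ hx]
    refine le_trans ?_ (hVlow _ h3)
    gcongr
  have hbound := exists_integral_indicator_le (μ := μ) (X := X)
    (𝓖 := fun k => pastAlg ξ k ⊔ pastAlg X k)
    (fun k => sup_le (pastAlg_le hnoise.measurable_ξ k) (pastAlg_le hX k))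
    (fun n j hj => Measurable.of_comap_le ((comap_le_pastAlg X hj).trans le_sup_right))
    ha ha0 hρ (show ρ < l by rw [hl]; linarith) hdec hφ0 hφs hVc hF hY hYM
    (show 0 ≤ 2 * (2 * Ch) by positivity) hcov (x := xs) (δ := δ)
    (show 0 < c₀ / 2 * δ ^ 2 by positivity) hH0 (show 0 ≤ 2 * H by positivity) hMpos.le
    (show 0 ≤ H * M₁ ^ 2 by positivity) hFb hFL
    (fun y hy => (abs_of_nonneg (hV.nonneg y)).trans_le (hVb y hy))
    (fun n ω _ => hinc n ω) hdrift hexit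
  refine ⟨0, ?_⟩
  have hset : {ν : Measure (EuclideanSpace ℝ (Fin d)) |
      ∃ n, 0 ≤ n ∧ ν = μ.map (fun ω => (√(a n))⁻¹ • (X n ω - xs))}
      = Set.range fun n => μ.map (fun ω => (√(a n))⁻¹ • (X n ω - xs)) := by
    ext ν
    simp [eq_comm]
  rw [hset]
  exact isTightMeasureSet_of_localized_bound hX hδ (half_pos hc₀) hlim ha hVc hV.nonneg hVb
    (fun y hy => hVlow y (Metric.closedBall_subset_closedBall (by linarith) hy)) hbound
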